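/- Let $\alpha\in[-1,1]\setminus\{0\}$, let $j_*\ge 1$ be an integer, and let $p\colon\mathbb R\to\mathbb R$ be $C^2$, even and strictly monotone on $[0,\infty)$, such that, for $|\xi|$ large, $|p(\xi)|\eqsim|\xi|^{\alpha}$, $|p'(\xi)|\eqsim|\xi|^{\alpha-1}$ and $|p''(\xi)|\lesssim|\xi|^{\alpha-2}$, and, for $|\xi|$ small, $p(\xi)=p(0)+\xi^{2j_*}\tilde p(\xi)$ with $\tilde p$ locally Lipschitz and $\tilde p(0)\neq0$. Write $\hat f(\xi)=\int_{\mathbb R} f(x)e^{-ix\xi}\,dx$, put $$m(a,b)=\frac{a+b}{2\,[\,p(a)a+p(b)b-p(a+b)(a+b)\,]},\qquad \widehat{B(f,g)}(\xi)=\int_{\mathbb R} m(\xi-\eta,\eta)\hat f(\xi-\eta)\hat g(\eta)\,d\eta ,$$ and define the modified energies $$E^{(k)}(u)=\|\partial_x^k u\|_{L^2}^2+2\big(\partial_x^k u,\partial_x^k B(u,u)\big)_{L^2}.$$ Since $m$ is singular at $a=0$ and at $b=0$ and grows at infinity, $E^{(k)}(u)$ is understood as a principal value: it is the limit as $\varepsilon\downarrow0$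 of the same expression with $m(a,b)$ replaced by $0$ unless $|a|$, $|b|$ and $|a+b|$ all lie in $(\varepsilon,1/\varepsilon)$. Let $N\ge\max\{2,2j_*-1\}$, let $\|u\|_{H^N}^2=\sum_{k=0}^N\|\partial_x^k u\|_{L^2}^2$, and put $$|||u|||_N^2=\|u\|_{L^2}^2+\sum_{k=2j_*-1}^N\|\partial_x^k u\|_{L^2}^2 .$$ Then there is a constant $C>0$, depending only on $p$, $\alpha$, $j_*$ and $N$, such that for every real-valued $u\in H^N(\mathbb R)$ (in particular for $u=u(t,\cdot)$ at any time $t$ of a solution of $\partial_tu+u\partial_xu-\mathcal L\partial_xu=0$ with values in $H^N(\mathbb R)$, where $\mathcal L$ is the Fourier multiplier with symbol $p$): 1. for $2j_*-1\le k\le N$ the limit defining $E^{(k)}(u)$ exists; and if $B(u,u)$ and $\partial_x^kB(u,u)$ lie in $L^2$ and the double integral in $(\xi,\eta)$ that expresses $(\partial_x^k u,\partial_x^k B(u,u))_{L^2}$ on the Fourier side converges absolutely, then the principal value agrees with the expression without truncation; 2. $\displaystyle\Big|\sum_{k=2j_*-1}^N E^{(k)}(u)+\|u\|_{L^2}^2-|||u|||_N^2\Big|\le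 C\,\|u\|_{H^2}\,|||u|||_N^2$, that is, $\sum_{k=2j_*-1}^N E^{(k)}(u)+\|u\|_{L^2}^2=\big(1+\mathcal O(\|u\|_{H^2})\big)|||u|||_N^2$; 3. $|||u|||_N\le\|u\|_{H^N}\le C\,|||u|||_N$, so that $|||\cdot|||_N$ is an equivalent norm of $H^N(\mathbb R)$ (and it equals $\|\cdot\|_{H^N}$ if $j_*=1$). -/

import Mathlib

open MeasureTheory Filter Topology
open scoped FourierTransform ComplexConjugate SchwartzMap

noncomputable section

namespace Whitham

/-- The complex Hilbert space `L²(ℝ)`. -/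
abbrev L2 : Type := Lp (α := ℝ) ℂ 2

/-- The assumptions on the symbol `p` of the dispersive operator, with order `α` at infinity and an
extremum of order `2 j` at the origin. The second derivative is only asked to satisfy the upper bound
`|p''(ξ)| ≲ |ξ| ^ (α - 2)`, so that `α = 1` is possible (for instance `p(ξ) = √(1 + ξ²)`). -/
structure IsSymbol (p : ℝ → ℝ) (α : ℝ) (j : ℕ) : Prop where
  contDiff : ContDiff ℝ 2 p
  even : ∀ ξ, p (-ξ) = p ξ
  strictMonotone : StrictMonoOn p (Set.Ici 0) ∨ StrictAntiOn p (Set.Ici 0)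
  farField : ∃ c > 0, ∃ C > 0, ∃ R > 0, ∀ ξ : ℝ, R ≤ |ξ| →
    (c * |ξ| ^ α ≤ |p ξ| ∧ |p ξ| ≤ C * |ξ| ^ α) ∧
    (c * |ξ| ^ (α - 1) ≤ |deriv p ξ| ∧ |deriv p ξ| ≤ C * |ξ| ^ (α - 1)) ∧
    |iteratedDeriv 2 p ξ| ≤ C * |ξ| ^ (α - 2)
  nearField : ∃ q : ℝ → ℝ, LocallyLipschitz q ∧ q 0 ≠ 0 ∧
    ∃ δ > 0, ∀ ξ : ℝ, |ξ| < δ → p ξ = p 0 + ξ ^ (2 * j) * q ξ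

/-- The Fourier transform of `f ∈ L²(ℝ)` in the normalization `∫ f(x) exp (-i x ξ) dx`; Mathlib's
transform `𝓕` has `exp (-2 π i x ζ)`. -/
def hat (f : L2) (ξ : ℝ) : ℂ := (𝓕 f : L2) (ξ / (2 * Real.pi))

open Classical in
/-- The element of `L²(ℝ)` whose transform `hat` is `g`, for square-integrable `g` (and `0` if `g`
is not square-integrable). -/
def ofHat (g : ℝ → ℂ) : L2 :=
  if h : MemLp (fun ζ : ℝ => g (2 * Real.pi * ζ)) 2 volume then 𝓕⁻ (h.toLp _ : L2) else 0

/-- The derivative `∂ₓᵏ f`, that is, the Fourier multiplier `(i ξ)ᵏ`. -/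
def dx (k : ℕ) (f : L2) : L2 := ofHat fun ξ => (Complex.I * ξ) ^ k * hat f ξ

/-- The real functions in the Sobolev space `Hᴺ(ℝ)`. -/
def IsRealSobolev (N : ℕ) (u : L2) : Prop :=
  (∀ᵐ x : ℝ, (u x).im = 0) ∧ TemperedDistribution.MemSobolev (N : ℝ) 2 (u : 𝓢'(ℝ, ℂ))

/-- The Sobolev norm, `‖u‖_{Hᴺ}² = ∑_{k=0}^N ‖∂ₓᵏ u‖²`. -/
def sobolevNorm (N : ℕ) (u : L2) : ℝ := √(∑ k ∈ Finset.range (N + 1), ‖dx k u‖ ^ 2)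

/-- The Sobolev norm in which the derivatives of orders `1, …, 2 j - 2` are left out,
`‖u‖² + ∑_{k=2j-1}^N ‖∂ₓᵏ u‖²`. For `j = 1` it is `sobolevNorm N`. -/
def energyNorm (j N : ℕ) (u : L2) : ℝ :=
  √(‖u‖ ^ 2 + ∑ k ∈ Finset.Icc (2 * j - 1) N, ‖dx k u‖ ^ 2)

/-- The multiplier `m(a, b)` of the normal form. -/
def mult (p : ℝ → ℝ) (a b : ℝ) : ℝ :=
  (a + b) / (2 * (p a * a + p b * b - p (a + b) * (a + b)))

open Classical in
/-- The multiplier `m` restricted to the frequencies with `ε < |a|, |b|, |a + b| < 1 / ε`. -/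
def truncMult (p : ℝ → ℝ) (ε a b : ℝ) : ℝ :=
  if (ε < |a| ∧ |a| < 1 / ε) ∧ (ε < |b| ∧ |b| < 1 / ε) ∧ (ε < |a + b| ∧ |a + b| < 1 / ε)
  then mult p a b else 0

/-- The transform of the pseudo-product of `f` and `g` with multiplier `μ`. -/
def pseudoHat (μ : ℝ → ℝ → ℝ) (f g : L2) (ξ : ℝ) : ℂ :=
  ∫ η : ℝ, (μ (ξ - η) η : ℂ) * hat f (ξ - η) * hat g η

/-- The pseudo-product of `f` and `g` with multiplier `μ`. -/
def pseudoProd (μ : ℝ → ℝ → ℝ) (f g : L2) : L2 := ofHat (pseudoHat μ f g)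

/-- `‖∂ₓᵏ u‖² + 2 (∂ₓᵏ u, ∂ₓᵏ B(u, u))₂`, where `B` is the pseudo-product with multiplier `μ`. -/
def energyWith (μ : ℝ → ℝ → ℝ) (k : ℕ) (u : L2) : ℝ :=
  ‖dx k u‖ ^ 2 + 2 * (inner ℂ (dx k u) (dx k (pseudoProd μ u u))).re

/-- The modified energy `‖∂ₓᵏ u‖² + 2 (∂ₓᵏ u, ∂ₓᵏ B(u, u))₂`. The multiplier `m` of `B` is singular at
`a = 0` and `b = 0`, like `1 / a` and `1 / b`, and grows at infinity, so that for a general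
`u ∈ Hᴺ` the integrals do not converge absolutely: the energy is their principal value. -/
def modifiedEnergy (p : ℝ → ℝ) (k : ℕ) (u : L2) : ℝ :=
  limUnder (𝓝[>] (0 : ℝ)) fun ε => energyWith (truncMult p ε) k u

/-- `B(u, u)` and `∂ₓᵏ B(u, u)` are in `L²` and the double integral for `(∂ₓᵏ u, ∂ₓᵏ B(u, u))₂`
converges absolutely, so that no principal value is needed. -/
def ConvergesAbsolutely (p : ℝ → ℝ) (k : ℕ) (u : L2) : Prop :=
  MemLp (pseudoHat (mult p) u u) 2 volume ∧
  MemLp (fun ξ : ℝ => (Complex.I * ξ) ^ k * pseudoHat (mult p) u u ξ) 2 volume ∧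
  Integrable (fun z : ℝ × ℝ => (z.1 : ℂ) ^ (2 * k) * conj (hat u z.1) *
    ((mult p (z.1 - z.2) z.2 : ℂ) * hat u (z.1 - z.2) * hat u z.2)) volume

end Whitham

end

open MeasureTheory Filter Topology
open scoped FourierTransform ComplexConjugate SchwartzMap

noncomputable section

namespace Whitham

/-! Write `v = hat u`, `a = ξ - η`, `b = η`, and let `phase p a b` be the resonance function, so
that `m = (a + b) / (2 * phase)`. On the Fourier side the cubic part of the energy is a constant
times the integral of `ξ ^ (2k+1) / phase` against `v(a) v(b) conj (v(a + b))`. With `c = -(a + b)`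
and `p` even, the phase is `p(a)a + p(b)b + p(c)c`, symmetric in three frequencies of sum zero. As
`u` is real, `conj (v(a + b)) = v(c)`, so the cubic product is symmetric too. Averaging over the
three frequencies replaces `ξ ^ (2k+1)` by `-(1/3) (a ^ (2k+1) + b ^ (2k+1) - (a+b) ^ (2k+1))`,
which vanishes wherever one of the frequencies does. This removes the singularities of `m`, and it
also lowers the growth at infinity.

Quantitatively, symmetry reduces to `0 < a ≤ b`. Monotonicity of `p` gives `|phase| ≥ a |p(a+b) -
p(a)|`, and `abs_sub_lower` bounds the increment below by a multiple of `min 1 (a+b) ^ (2j) /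
(1+a)`. The numerator is `O(a (a+b) ^ (2k))`. For `k ≥ j` the quotient is therefore at most a
constant times `(1+a) (1+b)^k (1+a+b)^k` (`symMult_le`): the smallest frequency carries one
derivative, the other two carry `k` each. Fubini and the Cauchy–Schwarz inequality bound the
integral by the `L¹` norm of `(1+|ξ|) v`, which `‖u‖_{H²}` controls, times the squared `L²` norm of
`(1+|ξ|)^k v`.

Before symmetrization the integral need not converge absolutely. The truncation is invariant under
the same symmetries and makes `1 / phase` bounded, so each truncated form may be symmetrized
(`integral_symmetrize`); dominated convergence then gives the limit. -/

/-! ### The Fourier transform on `L²` in the normalization of `hat` -/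

/-- The complex conjugate of a Schwartz function. -/
def conjSchwartz (f : 𝓢(ℝ, ℂ)) : 𝓢(ℝ, ℂ) where
  toFun x := conj (f x)
  smooth' := Complex.conjCLE.contDiff.comp (f.smooth _)
  decay' k n := by
    obtain ⟨C, hC⟩ := f.decay' k n
    refine ⟨C, fun x => ?_⟩
    have h := Complex.conjLIE.norm_iteratedFDeriv_comp_left (𝕜 := ℝ) f x n
    have e : (fun x => conj (f x)) = Complex.conjLIE ∘ f := by ext; simp
    rw [e, h]
    exact hC x

theorem conjSchwartz_apply (f : 𝓢(ℝ, ℂ)) (x : ℝ) : conjSchwartz f x = conj (f x) := rfl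

theorem fourier_conjSchwartz (f : 𝓢(ℝ, ℂ)) (x : ℝ) :
    𝓕 (conjSchwartz f) x = conj (𝓕 f (-x)) := by
  rw [SchwartzMap.fourier_coe, SchwartzMap.fourier_coe, Real.fourier_real_eq_integral_exp_smul,
    Real.fourier_real_eq_integral_exp_smul, ← integral_conj]
  congr 1
  ext y
  simp only [conjSchwartz_apply, smul_eq_mul, map_mul, ← Complex.exp_conj, Complex.conj_ofReal,
    Complex.conj_I]
  congr 2
  push_cast
  ring

/-- Both sides are continuous in `f`, so the identity for Schwartz functions extends by density.
Conjugation is only real-linear, hence the maps over `ℝ`. -/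
theorem fourier_conj (f : L2) :
    (𝓕 ((Complex.conjCLE : ℂ →L[ℝ] ℂ).compLp f : L2) : L2) =ᵐ[volume]
      fun x => conj ((𝓕 f : L2) (-x)) := by
  have hneg : MeasurePreserving (fun x : ℝ => -x) volume volume := Measure.measurePreserving_neg _
  set c : L2 →L[ℝ] L2 := (Complex.conjCLE : ℂ →L[ℝ] ℂ).compLpL 2 volume
  have key : ∀ f : L2, (𝓕 (c f) : L2) = c (Lp.compMeasurePreserving _ hneg (𝓕 f : L2)) := by
    intro f
    refine DenseRange.induction_on
      (p := fun f : L2 => (𝓕 (c f) : L2) = c (Lp.compMeasurePreserving _ hneg (𝓕 f : L2)))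
      (SchwartzMap.denseRange_toLpCLM (p := 2) ENNReal.ofNat_ne_top) f ?_ ?_
    · refine isClosed_eq ?_ ?_
      · exact (Lp.fourierTransformₗᵢ ℝ ℂ).continuous.comp c.continuous
      · exact c.continuous.comp ((Lp.isometry_compMeasurePreserving hneg).continuous.comp
          (Lp.fourierTransformₗᵢ ℝ ℂ).continuous)
    · intro g
      have h1 : c (g.toLp 2) = (conjSchwartz g).toLp 2 := by
        ext1
        filter_upwards [(Complex.conjCLE : ℂ →L[ℝ] ℂ).coeFn_compLpL (g.toLp 2 : L2),
          g.coeFn_toLp 2 volume, (conjSchwartz g).coeFn_toLp 2 volume] with x h1 h2 h3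
        rw [h1, h2, h3]; rfl
      change (𝓕 (c (g.toLp 2)) : L2) = c (Lp.compMeasurePreserving _ hneg (𝓕 (g.toLp 2) : L2))
      rw [h1, SchwartzMap.toLp_fourier_eq, SchwartzMap.toLp_fourier_eq]
      ext1
      filter_upwards [(Complex.conjCLE : ℂ →L[ℝ] ℂ).coeFn_compLpL
          (Lp.compMeasurePreserving _ hneg ((𝓕 g).toLp 2 : L2)),
        Lp.coeFn_compMeasurePreserving ((𝓕 g).toLp 2 : L2) hneg,
        hneg.quasiMeasurePreserving.ae ((𝓕 g).coeFn_toLp 2 volume),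
        (𝓕 (conjSchwartz g)).coeFn_toLp 2 volume] with x h1 h2 h3 h4
      rw [h1, h2, h4, fourier_conjSchwartz, Function.comp_apply, h3]; rfl
  have := key f
  rw [show (Complex.conjCLE : ℂ →L[ℝ] ℂ).compLp f = c f from rfl, this]
  filter_upwards [(Complex.conjCLE : ℂ →L[ℝ] ℂ).coeFn_compLpL
      (Lp.compMeasurePreserving _ hneg (𝓕 f : L2)),
    Lp.coeFn_compMeasurePreserving (𝓕 f : L2) hneg] with x h1 h2
  rw [h1, h2]; rfl

/-- Dilations preserve null sets; almost-everywhere statements about `𝓕` thus pass to `hat`, which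
differs by a factor `2π` in the argument. -/
theorem quasiMeasurePreserving_const_mul {c : ℝ} (hc : c ≠ 0) :
    Measure.QuasiMeasurePreserving (fun x : ℝ => c * x) volume volume :=
  Measure.quasiMeasurePreserving_smul volume hc

theorem quasiMeasurePreserving_div_const {c : ℝ} (hc : c ≠ 0) :
    Measure.QuasiMeasurePreserving (fun x : ℝ => x / c) volume volume := by
  simpa [div_eq_inv_mul] using quasiMeasurePreserving_const_mul (inv_ne_zero hc)

theorem memLp_two_comp_const_mul {g : ℝ → ℂ} (hg : MemLp g 2 volume) {c : ℝ} (hc : c ≠ 0) :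
    MemLp (fun x => g (c * x)) 2 volume := by
  have hm := hg.1.comp_quasiMeasurePreserving (quasiMeasurePreserving_const_mul hc)
  rw [memLp_two_iff_integrable_sq_norm hg.1] at hg
  exact (memLp_two_iff_integrable_sq_norm hm).2 (hg.comp_mul_left' hc)

theorem memLp_hat (f : L2) : MemLp (hat f) 2 volume := by
  have h := memLp_two_comp_const_mul (Lp.memLp (𝓕 f : L2)) (c := (2 * Real.pi)⁻¹) (by positivity)
  simp_rw [← div_eq_inv_mul] at h
  exact h

/-- This is the only place where the reality of `u` enters. -/
theorem hat_neg {u : L2} (hu : ∀ᵐ x : ℝ, (u x).im = 0) :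
    ∀ᵐ ξ : ℝ, hat u (-ξ) = conj (hat u ξ) := by
  have h : ((Complex.conjCLE : ℂ →L[ℝ] ℂ).compLp u : L2) = u := by
    ext1
    filter_upwards [(Complex.conjCLE : ℂ →L[ℝ] ℂ).coeFn_compLp u, hu] with x h1 h2
    rw [h1]
    exact Complex.conj_eq_iff_im.2 h2
  have h2 := fourier_conj u
  rw [h] at h2
  filter_upwards [(quasiMeasurePreserving_div_const (c := 2 * Real.pi) (by positivity)).ae h2]
    with ξ h3
  simp only [hat, h3, neg_div, Complex.conj_conj]

theorem hat_ofHat {g : ℝ → ℂ} (hg : MemLp g 2 volume) : hat (ofHat g) =ᵐ[volume] g := by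
  have h := memLp_two_comp_const_mul hg (c := 2 * Real.pi) (by positivity)
  filter_upwards [(quasiMeasurePreserving_div_const (c := 2 * Real.pi) (by positivity)).ae
    h.coeFn_toLp] with ξ hξ
  rw [hat, ofHat, dif_pos h, FourierTransform.fourier_fourierInv_eq, hξ]
  congr 1
  field_simp

theorem inner_eq_integral_hat (f g : L2) :
    inner ℂ f g = ((2 * Real.pi)⁻¹ : ℝ) * ∫ ξ, conj (hat f ξ) * hat g ξ := by
  have h := Measure.integral_comp_div (fun ζ => conj ((𝓕 f : L2) ζ) * (𝓕 g : L2) ζ) (2 * Real.pi)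
  rw [← Lp.inner_fourier_eq f g, L2.inner_def]
  simp only [hat]
  rw [h, abs_of_pos (by positivity), Complex.real_smul, ← mul_assoc, ← Complex.ofReal_mul,
    inv_mul_cancel₀ (by positivity), Complex.ofReal_one, one_mul]
  congr 1
  ext x
  rw [RCLike.inner_apply']

theorem norm_sq_eq_integral_hat (f : L2) :
    ‖f‖ ^ 2 = (2 * Real.pi)⁻¹ * ∫ ξ, ‖hat f ξ‖ ^ 2 := by
  have h := inner_eq_integral_hat f f
  simp_rw [Complex.conj_mul'] at h
  rw [inner_self_eq_norm_sq_to_K] at h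
  norm_cast at h
  exact Complex.ofReal_injective h

/-- The Fourier transform of an element of `Hᴺ` is square integrable after multiplication by `(1 + |ξ|)ᴺ`. -/
theorem memLp_weight_hat {N : ℕ} {u : L2}
    (hu : TemperedDistribution.MemSobolev (N : ℝ) 2 (u : 𝓢'(ℝ, ℂ))) :
    MemLp (fun ξ => ((1 + |ξ|) ^ N : ℝ) * hat u ξ) 2 volume := by
  obtain ⟨f', hf'⟩ := TemperedDistribution.memSobolev_iff_exists_smulLeftCLM_fourier.1 hu
  rw [Lp.fourier_toTemperedDistribution_eq] at hf'
  set g : ℝ → ℂ := fun x => (((1 + ‖x‖ ^ 2) ^ (-(N : ℝ) / 2) : ℝ) : ℂ) with hg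
  have hgt : g.HasTemperateGrowth := by rw [hg]; fun_prop
  have hgb : ∀ x, ‖g x‖ ≤ 1 := by
    intro x
    rw [hg, Complex.norm_real, Real.norm_eq_abs, abs_of_nonneg (by positivity)]
    exact Real.rpow_le_one_of_one_le_of_nonpos (by simp [sq_nonneg]) (by
      have : (0 : ℝ) ≤ N := N.cast_nonneg
      linarith)
  have hgm : MemLp g ⊤ volume :=
    memLp_top_of_bound hgt.1.continuous.aestronglyMeasurable 1 (Eventually.of_forall hgb)
  -- The Sobolev condition is an identity of tempered distributions. Multiplying by the inverse
  -- weight `g` and using that `L²` embeds injectively turns it into an identity in `L²`.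
  have hw : (𝓕 u : L2) = (hgm.toLp g • f' : L2) := by
    have hi := LinearMap.ker_eq_bot.1 (Lp.ker_toTemperedDistributionCLM_eq_bot
      (F := ℂ) (μ := (volume : Measure ℝ)) (p := 2))
    apply hi
    change ((𝓕 u : L2) : 𝓢'(ℝ, ℂ)) = ((hgm.toLp g • f' : L2) : 𝓢'(ℝ, ℂ))
    rw [Lp.toTemperedDistribution_smul_eq hgt hgm f', ← hf',
      TemperedDistribution.smulLeftCLM_smulLeftCLM_apply (by fun_prop) (by fun_prop)]
    have e : (fun x : ℝ => (((1 + ‖x‖ ^ 2) ^ ((N : ℝ) / 2) : ℝ) : ℂ)) * g = fun _ => 1 := by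
      ext x
      rw [Pi.mul_apply, hg]
      beta_reduce
      rw [← Complex.ofReal_mul, ← Real.rpow_add (by positivity), neg_div, add_neg_cancel,
        Real.rpow_zero, Complex.ofReal_one]
    rw [e]
    simp
  have hm : MemLp (fun ζ => (((1 + |2 * Real.pi * ζ|) ^ N : ℝ) : ℂ) * (𝓕 u : L2) ζ) 2 volume := by
    -- The factor `10 ^ N` comes from `1 + 2π|ζ| ≤ 10 √(1 + ζ²)`, proved below.
    refine (Lp.memLp f').of_le_mul (c := 10 ^ N) ?_ ?_
    · exact (by fun_prop : Continuous fun ζ : ℝ =>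
        (((1 + |2 * Real.pi * ζ|) ^ N : ℝ) : ℂ)).aestronglyMeasurable.mul
        (Lp.aestronglyMeasurable _)
    · rw [hw]
      filter_upwards [Lp.coeFn_lpSMul (r := 2) (hgm.toLp g) f', hgm.coeFn_toLp] with ζ h1 h2
      rw [h1, Pi.smul_apply', h2, smul_eq_mul, ← mul_assoc, norm_mul, norm_mul]
      gcongr
      rw [hg, Complex.norm_real, Complex.norm_real, Real.norm_of_nonneg (by positivity),
        Real.norm_of_nonneg (by positivity), neg_div, Real.rpow_neg (by positivity),
        Real.rpow_div_two_eq_sqrt _ (by positivity), Real.rpow_natCast, ← div_eq_mul_inv,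
        ← div_pow]
      gcongr
      rw [div_le_iff₀ (by positivity)]
      have hs : √(1 + ‖ζ‖ ^ 2) ^ 2 = 1 + |ζ| ^ 2 := Real.sq_sqrt (by positivity)
      refine abs_le_of_sq_le_sq' ?_ (by positivity) |>.2
      rw [mul_pow, hs, abs_mul, abs_of_pos (by positivity : 0 < 2 * Real.pi)]
      have h4 := Real.pi_lt_four
      have h3 : Real.pi < 3.15 := Real.pi_lt_d2
      have h5 : 2 * Real.pi * |ζ| ≤ 6.3 * |ζ| := by gcongr; linarith
      have h6 : 0 ≤ 2 * Real.pi * |ζ| := by positivity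
      nlinarith [sq_nonneg (1 - |ζ|), abs_nonneg ζ]
  have h := memLp_two_comp_const_mul hm (c := (2 * Real.pi)⁻¹) (by positivity)
  refine h.ae_eq (Eventually.of_forall fun ξ => ?_)
  have e : 2 * Real.pi * ((2 * Real.pi)⁻¹ * ξ) = ξ := by field_simp
  simp only [e, hat, div_eq_inv_mul]

/-! ### Lower bounds for the phase -/

/-- The increment of a monotone function grows with the interval. Absolute values treat increasing
and decreasing symbols together. -/
theorem IsSymbol.abs_sub_mono {p : ℝ → ℝ} {α : ℝ} {j : ℕ} (hp : IsSymbol p α j)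
    {a b c d : ℝ} (ha : 0 ≤ a) (hab : a ≤ b) (hbc : b ≤ c) (hcd : c ≤ d) :
    |p c - p b| ≤ |p d - p a| := by
  have hb : 0 ≤ b := ha.trans hab
  have hc : 0 ≤ c := hb.trans hbc
  have hd : 0 ≤ d := hc.trans hcd
  rcases hp.strictMonotone with h | h
  · have h1 := h.monotoneOn ha hb hab
    have h2 := h.monotoneOn hb hc hbc
    have h3 := h.monotoneOn hc hd hcd
    rw [abs_of_nonneg (by linarith), abs_of_nonneg (by linarith)]
    linarith
  · have h1 := h.antitoneOn ha hb hab
    have h2 := h.antitoneOn hb hc hbc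
    have h3 := h.antitoneOn hc hd hcd
    rw [abs_of_nonpos (by linarith), abs_of_nonpos (by linarith)]
    linarith

theorem IsSymbol.abs_sub_pos {p : ℝ → ℝ} {α : ℝ} {j : ℕ} (hp : IsSymbol p α j)
    {a c : ℝ} (ha : 0 ≤ a) (hac : a < c) : 0 < |p c - p a| := by
  rw [abs_pos, sub_ne_zero]
  rcases hp.strictMonotone with h | h
  · exact (h ha (ha.trans hac.le) hac).ne'
  · exact (h ha (ha.trans hac.le) hac).ne

/-- The increment is `c ^ (2j)` times a continuous function of `c` whose value at `0` is `(1 - 2 ^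
(-2j)) q(0) ≠ 0`. -/
theorem IsSymbol.near_lower {p : ℝ → ℝ} {α : ℝ} {j : ℕ} (hj : 1 ≤ j) (hp : IsSymbol p α j) :
    ∃ κ > 0, ∃ r > 0, ∀ c, 0 ≤ c → c ≤ r → κ * c ^ (2 * j) ≤ |p c - p (c / 2)| := by
  obtain ⟨q, hq, hq0, δ, hδ, h⟩ := hp.nearField
  have hqc : Continuous q := hq.continuous
  have hlt : ((1 : ℝ) / 2) ^ (2 * j) < 1 := pow_lt_one₀ (by norm_num) (by norm_num) (by omega)
  have hcont : Continuous fun c => |q c - (1 / 2) ^ (2 * j) * q (c / 2)| := by fun_prop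
  have h0 : 0 < |q 0 - (1 / 2) ^ (2 * j) * q (0 / 2)| := by
    rw [zero_div, abs_pos, ← one_sub_mul]
    exact mul_ne_zero (by linarith) hq0
  obtain ⟨r, hr, hr'⟩ := Metric.eventually_nhds_iff.1
    (hcont.continuousAt.eventually (lt_mem_nhds (half_lt_self h0)))
  refine ⟨_, half_pos h0, min (r / 2) (δ / 2), by positivity, fun c hc hcr => ?_⟩
  have h1 : c < r := by have := min_le_left (r / 2) (δ / 2); linarith
  have h2 : c < δ := by have := min_le_right (r / 2) (δ / 2); linarith
  have h3 := hr' (y := c) (by rwa [Real.dist_eq, sub_zero, abs_of_nonneg hc])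
  rw [h c (by rwa [abs_of_nonneg hc]),
    h (c / 2) (by rw [abs_of_nonneg (by positivity)]; linarith)]
  have e : p 0 + c ^ (2 * j) * q c - (p 0 + (c / 2) ^ (2 * j) * q (c / 2))
      = (q c - (1 / 2) ^ (2 * j) * q (c / 2)) * c ^ (2 * j) := by
    rw [div_pow, div_pow]; ring
  rw [e, abs_mul, abs_of_nonneg (pow_nonneg hc _)]
  gcongr

/-- By the mean value theorem the increment is `a p'(x)` with `a < x < 2a`. Since `α ≥ -1`,
`|p'(x)|` is at least a multiple of `x ^ (-2)`, hence of `a ^ (-2)`. -/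
theorem IsSymbol.far_lower {p : ℝ → ℝ} {α : ℝ} {j : ℕ} (hα : α ∈ Set.Icc (-1 : ℝ) 1)
    (hp : IsSymbol p α j) :
    ∃ κ > 0, ∃ R ≥ 1, ∀ a, R ≤ a → κ / a ≤ |p (2 * a) - p a| := by
  obtain ⟨c, hc, C, -, R, hR, h⟩ := hp.farField
  refine ⟨c / 4, by positivity, max R 1, le_max_right _ _, fun a ha => ?_⟩
  have haR : R ≤ a := (le_max_left _ _).trans ha
  have ha1 : 1 ≤ a := (le_max_right _ _).trans ha
  have ha0 : 0 < a := by linarith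
  have hd : Differentiable ℝ p := hp.contDiff.differentiable (by norm_num)
  obtain ⟨x, hx, hx'⟩ := exists_deriv_eq_slope p (by linarith : a < 2 * a)
    hp.contDiff.continuous.continuousOn hd.differentiableOn
  have hxa : 0 < x := ha0.trans hx.1
  have e : p (2 * a) - p a = deriv p x * a := by
    rw [hx']; field_simp; ring
  have h1 := (h x (by rw [abs_of_pos hxa]; linarith [hx.1])).2.1.1
  rw [abs_of_pos hxa] at h1
  rw [e, abs_mul, abs_of_pos ha0]
  have h2 : (x : ℝ) ^ (-2 : ℝ) ≤ x ^ (α - 1) :=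
    Real.rpow_le_rpow_of_exponent_le (by linarith [hx.1]) (by linarith [hα.1])
  have h3 : 1 / (4 * a ^ 2) ≤ (x : ℝ) ^ (-2 : ℝ) := by
    rw [Real.rpow_neg hxa.le, Real.rpow_two, one_div]
    gcongr
    nlinarith [hx.2]
  calc c / 4 / a = c * (1 / (4 * a ^ 2)) * a := by field_simp
    _ ≤ |deriv p x| * a := by
      gcongr
      exact (mul_le_mul_of_nonneg_left (h3.trans h2) hc.le).trans h1

theorem IsSymbol.abs_sub_lower {p : ℝ → ℝ} {α : ℝ} {j : ℕ} (hα : α ∈ Set.Icc (-1 : ℝ) 1)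
    (hj : 1 ≤ j) (hp : IsSymbol p α j) :
    ∃ κ > 0, ∀ a c, 0 ≤ a → 2 * a ≤ c → κ * min 1 c ^ (2 * j) / (1 + a) ≤ |p c - p a| := by
  obtain ⟨κ₁, hκ₁, r, hr, h1⟩ := hp.near_lower hj
  obtain ⟨κ₂, hκ₂, R, hR, h2⟩ := hp.far_lower hα
  have hcont : Continuous fun c => |p c - p (c / 2)| := by
    have := hp.contDiff.continuous
    fun_prop
  -- Intermediate `c` are handled by compactness; the `max` only keeps the interval nonempty.
  have hne : (Set.Icc r (max r (2 * R))).Nonempty := ⟨r, le_rfl, le_max_left _ _⟩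
  obtain ⟨c₀, hc₀, hmin⟩ := isCompact_Icc.exists_isMinOn hne hcont.continuousOn
  set κ₃ := |p c₀ - p (c₀ / 2)|
  have hκ₃ : 0 < κ₃ := hp.abs_sub_pos (by linarith [hc₀.1]) (by linarith [hc₀.1])
  set κ₄ := |p (2 * R) - p R|
  have hκ₄ : 0 < κ₄ := hp.abs_sub_pos (by linarith) (by linarith)
  set κ := min (min κ₁ κ₂) (min κ₃ κ₄)
  have hκ : 0 < κ := by positivity
  refine ⟨κ, hκ, fun a c ha hac => ?_⟩
  have hc : 0 ≤ c := by linarith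
  have k1 : κ ≤ κ₁ := (min_le_left _ _).trans (min_le_left _ _)
  have k2 : κ ≤ κ₂ := (min_le_left _ _).trans (min_le_right _ _)
  have k3 : κ ≤ κ₃ := (min_le_right _ _).trans (min_le_left _ _)
  have k4 : κ ≤ κ₄ := (min_le_right _ _).trans (min_le_right _ _)
  have hm0 : 0 ≤ min 1 c := le_min zero_le_one hc
  have hm1 : min 1 c ^ (2 * j) ≤ 1 := pow_le_one₀ hm0 (min_le_left _ _)
  have hpos : 0 ≤ κ * min 1 c ^ (2 * j) := by positivity
  have hle : κ * min 1 c ^ (2 * j) / (1 + a) ≤ κ * min 1 c ^ (2 * j) :=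
    div_le_self hpos (by linarith)
  have hle' : κ * min 1 c ^ (2 * j) ≤ κ := mul_le_of_le_one_right hκ.le hm1
  rcases le_total c r with hcr | hcr
  · calc _ ≤ κ * min 1 c ^ (2 * j) := hle
      _ ≤ κ₁ * c ^ (2 * j) := by gcongr; exact min_le_right _ _
      _ ≤ |p c - p (c / 2)| := h1 c hc hcr
      _ ≤ |p c - p a| := hp.abs_sub_mono ha (by linarith) (by linarith) le_rfl
  rcases le_total R a with haR | haR
  · calc _ ≤ κ / (1 + a) := by gcongr
      _ ≤ κ₂ / a := by gcongr; · linarith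
                       · linarith
      _ ≤ |p (2 * a) - p a| := h2 a haR
      _ ≤ |p c - p a| := hp.abs_sub_mono ha le_rfl (by linarith) hac
  rcases le_total c (2 * R) with hcR | hcR
  · calc _ ≤ κ₃ := (hle.trans hle').trans k3
      _ ≤ |p c - p (c / 2)| := hmin ⟨hcr, hcR.trans (le_max_right _ _)⟩
      _ ≤ |p c - p a| := hp.abs_sub_mono ha (by linarith) (by linarith) le_rfl
  -- What remains is `a ≤ R` and `2R ≤ c`, so `[a, c]` contains `[R, 2R]`.
  · calc _ ≤ κ₄ := (hle.trans hle').trans k4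
      _ ≤ |p c - p a| := hp.abs_sub_mono ha haR (by linarith) hcR

/-- The resonance function of the quadratic interaction. -/
def phase (p : ℝ → ℝ) (a b : ℝ) : ℝ := p a * a + p b * b - p (a + b) * (a + b)

theorem phase_swap (p : ℝ → ℝ) (a b : ℝ) : phase p b a = phase p a b := by
  rw [phase, phase, add_comm b a]; ring

theorem phase_neg {p : ℝ → ℝ} (hp : ∀ ξ, p (-ξ) = p ξ) (a b : ℝ) :
    phase p (-a) (-b) = -phase p a b := by
  rw [phase, phase, ← neg_add, hp, hp, hp]; ring

/-- With `c = -(a + b)` and `p` even, the phase is `p(a)a + p(b)b + p(c)c`, so `a` and `c` may be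
exchanged. -/
theorem phase_rot {p : ℝ → ℝ} (hp : ∀ ξ, p (-ξ) = p ξ) (a b : ℝ) :
    phase p (-(a + b)) b = phase p a b := by
  rw [phase, phase, show -(a + b) + b = -a by ring, hp, hp]; ring

/-- Up to sign the phase is `a (p(a+b) - p(a)) + b (p(a+b) - p(b))`. Monotonicity gives both terms
the same sign, so there is no cancellation and the second may be dropped. -/
theorem IsSymbol.phase_lower {p : ℝ → ℝ} {α : ℝ} {j : ℕ} (hp : IsSymbol p α j) {a b : ℝ}
    (ha : 0 ≤ a) (hb : 0 ≤ b) : a * |p (a + b) - p a| ≤ |phase p a b| := by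
  have e : phase p a b = -(a * (p (a + b) - p a) + b * (p (a + b) - p b)) := by
    rw [phase]; ring
  have hab : 0 ≤ a + b := by positivity
  rw [e, abs_neg]
  rcases hp.strictMonotone with h | h
  · have h1 := h.monotoneOn ha hab (by linarith)
    have h2 := h.monotoneOn hb hab (by linarith)
    rw [abs_of_nonneg (by linarith)]
    refine (le_add_of_nonneg_right ?_).trans (le_abs_self _)
    exact mul_nonneg hb (by linarith)
  · have h1 := h.antitoneOn ha hab (by linarith)
    have h2 := h.antitoneOn hb hab (by linarith)
    rw [abs_of_nonpos (by linarith)]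
    refine le_trans ?_ (neg_le_abs _)
    have := mul_nonneg hb (by linarith : 0 ≤ p b - p (a + b))
    linarith

/-- A property of interacting frequencies that does not depend on their order and signs may be
checked for positive frequencies. -/
theorem frequency_induction {P : ℝ → ℝ → Prop} (swap : ∀ a b, P a b → P b a)
    (neg : ∀ a b, P a b → P (-a) (-b)) (rot : ∀ a b, P a b → P (-(a + b)) b)
    (h : ∀ a b, 0 < a → a ≤ b → P a b) {a b : ℝ} (ha : a ≠ 0) (hb : b ≠ 0) (hab : a + b ≠ 0) :
    P a b := by
  have h1 : ∀ a b, 0 < a → 0 < b → P a b := fun a b ha hb => by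
    rcases le_total a b with hab | hab
    · exact h a b ha hab
    · exact swap _ _ (h b a hb hab)
  have h2 : ∀ a b, 0 < a → b ≠ 0 → a + b ≠ 0 → P a b := fun a b ha hb hab => by
    rcases hb.lt_or_gt with hb | hb
    -- Among `a`, `b`, `-(a + b)` two have the same sign: here `a` and `-(a + b)` are positive if `a
    -- + b < 0`, and otherwise `b` and `-(a + b)` are negative. The symmetries move that pair into
    -- the two slots.
    · rcases hab.lt_or_gt with hab | hab
      · have h3 := rot _ _ (swap _ _ (h1 a (-(a + b)) ha (by linarith)))
        have h4 := swap _ _ h3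
        convert h4 using 1; ring
      · have h3 := neg _ _ (h1 (a + b) (-b) hab (by linarith))
        have h4 := rot _ _ h3
        convert h4 using 1 <;> ring
    · exact h1 a b ha hb
  rcases ha.lt_or_gt with ha | ha
  · have h3 := neg _ _ (h2 (-a) (-b) (by linarith) (neg_ne_zero.2 hb)
      (by rwa [← neg_add, neg_ne_zero]))
    simpa using h3
  · exact h2 a b ha hb hab

/-- The truncated frequencies. -/
def truncSet (ε : ℝ) : Set (ℝ × ℝ) :=
  {z | (ε < |z.1| ∧ |z.1| < 1 / ε) ∧ (ε < |z.2| ∧ |z.2| < 1 / ε) ∧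
    (ε < |z.1 + z.2| ∧ |z.1 + z.2| < 1 / ε)}

theorem mem_truncSet_swap {ε a b : ℝ} : (b, a) ∈ truncSet ε ↔ (a, b) ∈ truncSet ε := by
  simp only [truncSet, Set.mem_ofPred_eq, add_comm b a]; tauto

theorem mem_truncSet_neg {ε a b : ℝ} : (-a, -b) ∈ truncSet ε ↔ (a, b) ∈ truncSet ε := by
  simp only [truncSet, Set.mem_ofPred_eq, ← neg_add, abs_neg]

theorem mem_truncSet_rot {ε a b : ℝ} : (-(a + b), b) ∈ truncSet ε ↔ (a, b) ∈ truncSet ε := by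
  simp only [truncSet, Set.mem_ofPred_eq, show -(a + b) + b = -a by ring, abs_neg]; tauto

theorem IsSymbol.exists_le_phase_of_mem_truncSet {p : ℝ → ℝ} {α : ℝ} {j : ℕ}
    (hα : α ∈ Set.Icc (-1 : ℝ) 1) (hj : 1 ≤ j) (hp : IsSymbol p α j) {ε : ℝ} (hε : 0 < ε) :
    ∃ δ > 0, ∀ a b, (a, b) ∈ truncSet ε → δ ≤ |phase p a b| := by
  obtain ⟨κ, hκ, h⟩ := hp.abs_sub_lower hα hj
  refine ⟨ε * (κ * min 1 ε ^ (2 * j) / (1 + 1 / ε)), by positivity, fun a b hab => ?_⟩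
  obtain ⟨h1, h2, h3⟩ := id hab
  refine frequency_induction
    (P := fun a b => (a, b) ∈ truncSet ε →
      ε * (κ * min 1 ε ^ (2 * j) / (1 + 1 / ε)) ≤ |phase p a b|)
    (fun a b H H' => by rw [phase_swap]; exact H (mem_truncSet_swap.1 H'))
    (fun a b H H' => by rw [phase_neg hp.even, abs_neg]; exact H (mem_truncSet_neg.1 H'))
    (fun a b H H' => by rw [phase_rot hp.even]; exact H (mem_truncSet_rot.1 H'))
    (fun a b ha hb H => ?_) (abs_pos.1 (hε.trans h1.1)) (abs_pos.1 (hε.trans h2.1))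
    (abs_pos.1 (hε.trans h3.1)) hab
  obtain ⟨h1, h2, h3⟩ := H
  simp only [abs_of_pos ha, abs_of_pos (ha.trans_le hb),
    abs_of_pos (add_pos ha (ha.trans_le hb))] at h1 h2 h3
  refine le_trans ?_ (hp.phase_lower ha.le (ha.le.trans hb))
  have := h a (a + b) ha.le (by linarith)
  refine mul_le_mul h1.1.le (le_trans ?_ this) (by positivity) ha.le
  have hb0 : 0 < b := ha.trans_le hb
  gcongr
  · exact h3.1.le
  · exact h1.2.le

/-- The symmetrized multiplier of the energy of order `k`. -/
def symMult (p : ℝ → ℝ) (k : ℕ) (a b : ℝ) : ℝ :=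
  (a ^ (2 * k + 1) + b ^ (2 * k + 1) - (a + b) ^ (2 * k + 1)) / phase p a b

/-- The weight that controls the symmetrized multiplier. -/
def triWeight (k : ℕ) (a b : ℝ) : ℝ :=
  (1 + |a|) * ((1 + |b|) ^ k * (1 + |a + b|) ^ k) +
  (1 + |b|) * ((1 + |a|) ^ k * (1 + |a + b|) ^ k) +
  (1 + |a + b|) * ((1 + |a|) ^ k * (1 + |b|) ^ k)

/-- The difference `(a+b) ^ (2k+1) - b ^ (2k+1)` is `a` times a sum of `2k+1` monomials, each at
most `(a+b) ^ (2k)`. The resulting factor `a` cancels the one in `phase_lower`. -/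
theorem abs_odd_power_defect_le (k : ℕ) {a b : ℝ} (ha : 0 ≤ a) (hb : 0 ≤ b) :
    |a ^ (2 * k + 1) + b ^ (2 * k + 1) - (a + b) ^ (2 * k + 1)|
      ≤ (2 * k + 2) * (a * (a + b) ^ (2 * k)) := by
  have h1 : a ^ (2 * k + 1) ≤ a * (a + b) ^ (2 * k) := by
    rw [pow_succ']; gcongr; linarith
  have h2 : (a + b) ^ (2 * k + 1) - b ^ (2 * k + 1)
      ≤ (2 * k + 1) * (a * (a + b) ^ (2 * k)) := by
    rw [← Commute.geom_sum₂_mul (Commute.all _ _), add_sub_cancel_right,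
      mul_left_comm, mul_comm a]
    gcongr
    have : ∀ i ∈ Finset.range (2 * k + 1),
        (a + b) ^ i * b ^ (2 * k + 1 - 1 - i) ≤ (a + b) ^ (2 * k) := fun i hi => by
      have hi' := Finset.mem_range.1 hi
      calc (a + b) ^ i * b ^ (2 * k + 1 - 1 - i)
          ≤ (a + b) ^ i * (a + b) ^ (2 * k + 1 - 1 - i) := by gcongr; linarith
        _ = (a + b) ^ (2 * k) := by rw [← pow_add]; congr 1; omega
    refine (Finset.sum_le_sum this).trans (le_of_eq ?_)
    simp
  have h3 : b ^ (2 * k + 1) ≤ (a + b) ^ (2 * k + 1) := by gcongr; linarith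
  have h4 : 0 ≤ a ^ (2 * k + 1) := by positivity
  have h5 : 0 ≤ a * (a + b) ^ (2 * k) := by positivity
  rw [abs_le]
  constructor <;> nlinarith [(Nat.cast_nonneg k : (0 : ℝ) ≤ k)]

theorem IsSymbol.symMult_le {p : ℝ → ℝ} {α : ℝ} {j : ℕ} (hα : α ∈ Set.Icc (-1 : ℝ) 1)
    (hj : 1 ≤ j) (hp : IsSymbol p α j) {k : ℕ} (hk : j ≤ k) :
    ∃ C > 0, ∀ a b, |symMult p k a b| ≤ C * triWeight k a b := by
  obtain ⟨κ, hκ, h⟩ := hp.abs_sub_lower hα hj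
  refine ⟨(2 * k + 2) * 2 ^ k / κ, by positivity, fun a b => ?_⟩
  have hodd : Odd (2 * k + 1) := ⟨k, rfl⟩
  have hz : 0 ≤ (2 * k + 2) * 2 ^ k / κ * triWeight k a b := by unfold triWeight; positivity
  -- On the three lines where a frequency vanishes the numerator is zero, so the quotient is zero
  -- whatever the phase.
  by_cases ha : a = 0
  · subst ha; simpa [symMult] using hz
  by_cases hb : b = 0
  · subst hb; simpa [symMult] using hz
  by_cases hab : a + b = 0
  · obtain rfl : b = -a := by linarith
    simpa [symMult, hodd.neg_pow] using hz
  refine frequency_induction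
    (P := fun a b => |symMult p k a b| ≤ (2 * k + 2) * 2 ^ k / κ * triWeight k a b)
    (fun a b H => ?_) (fun a b H => ?_) (fun a b H => ?_) (fun a b ha hb => ?_) ha hb hab
  · convert H using 2
    · rw [symMult, symMult, phase_swap, add_comm b a]; ring_nf
    · rw [triWeight, triWeight, add_comm b a]; ring
  · convert H using 2
    · rw [symMult, symMult, phase_neg hp.even, ← neg_add, hodd.neg_pow, hodd.neg_pow,
        hodd.neg_pow, div_neg, ← neg_div]
      ring_nf
    · simp only [triWeight, ← neg_add, abs_neg]
  · convert H using 2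
    · rw [symMult, symMult, phase_rot hp.even, show -(a + b) + b = -a by ring, hodd.neg_pow,
        hodd.neg_pow]
      ring_nf
    · rw [triWeight, triWeight, show -(a + b) + b = -a by ring, abs_neg, abs_neg]; ring
  have hb0 : 0 < b := ha.trans_le hb
  set c := a + b with hc
  have hc0 : 0 < c := by positivity
  have hm : 0 < min 1 c := by positivity
  have hph : a * (κ * min 1 c ^ (2 * j) / (1 + a)) ≤ |phase p a b| :=
    (mul_le_mul_of_nonneg_left (h a c ha.le (by linarith)) ha.le).trans
      (hp.phase_lower ha.le hb0.le)
  -- This is where `j ≤ k` is needed: for small `c` the numerator must absorb the flatness `c ^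
  -- (2j)` of the symbol.
  have hcm : c ^ (2 * k) ≤ (1 + c) ^ (2 * k) * min 1 c ^ (2 * j) := by
    rcases le_total 1 c with h1 | h1
    · rw [min_eq_left h1, one_pow, mul_one]; gcongr; linarith
    · rw [min_eq_right h1]
      calc c ^ (2 * k) ≤ c ^ (2 * j) := pow_le_pow_of_le_one hc0.le h1 (by omega)
        _ ≤ _ := le_mul_of_one_le_left (by positivity) (one_le_pow₀ (by linarith))
  -- As `c ≤ 2b`, half of the `2k` powers of `1 + c` can be moved to the other large frequency `b`.
  have hcb : (1 + c) ^ k ≤ 2 ^ k * (1 + b) ^ k := by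
    rw [← mul_pow]; gcongr; linarith
  have hS : |symMult p k a b| ≤ (2 * k + 2) * 2 ^ k / κ *
      ((1 + a) * ((1 + b) ^ k * (1 + c) ^ k)) := by
    rw [symMult, abs_div]
    calc _ ≤ (2 * k + 2) * (a * c ^ (2 * k)) / (a * (κ * min 1 c ^ (2 * j) / (1 + a))) := by
          gcongr
          exact abs_odd_power_defect_le k ha.le hb0.le
      _ ≤ (2 * k + 2) * (a * ((1 + c) ^ (2 * k) * min 1 c ^ (2 * j))) /
          (a * (κ * min 1 c ^ (2 * j) / (1 + a))) := by gcongr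
      _ = (2 * k + 2) / κ * ((1 + a) * ((1 + c) ^ k * (1 + c) ^ k)) := by
          rw [two_mul k, pow_add]; field_simp
      _ ≤ (2 * k + 2) / κ * ((1 + a) * (2 ^ k * (1 + b) ^ k * (1 + c) ^ k)) := by gcongr
      _ = _ := by ring
  refine hS.trans ?_
  gcongr
  rw [triWeight, abs_of_pos ha, abs_of_pos hb0, ← hc, abs_of_pos hc0, add_assoc]
  exact le_add_of_nonneg_right (by positivity)

/-! ### Trilinear integrals -/

theorem measurePreserving_sub_right_coord :
    MeasurePreserving (fun z : ℝ × ℝ => (z.1, z.1 - z.2)) volume volume :=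
  (MeasurePreserving.id (volume : Measure ℝ)).skew_product (g := fun x y => x - y)
    (measurable_fst.sub measurable_snd)
    (ae_of_all _ fun x => (Measure.measurePreserving_sub_left volume x).map_eq)

theorem measurePreserving_neg_swap :
    MeasurePreserving (fun z : ℝ × ℝ => (-z.2, -z.1)) volume volume :=
  ((Measure.measurePreserving_neg (volume : Measure ℝ)).prod
    (Measure.measurePreserving_neg (volume : Measure ℝ))).comp Measure.measurePreserving_swap

theorem quasiMeasurePreserving_sub :
    Measure.QuasiMeasurePreserving (fun z : ℝ × ℝ => z.1 - z.2) volume volume :=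
  quasiMeasurePreserving_sub_of_right_invariant volume volume

/-- Integrability of `f` makes it unnecessary that `φ` be a measurable embedding. -/
theorem MeasurePreserving.integral_comp_of_integrable {E : Type*} [NormedAddCommGroup E]
    [NormedSpace ℝ E] {X : Type*} [MeasurableSpace X] {μ : Measure X} {φ : X → X}
    (hφ : MeasurePreserving φ μ μ) {f : X → E} (hf : Integrable f μ) :
    ∫ x, f (φ x) ∂μ = ∫ x, f x ∂μ := by
  conv_rhs => rw [← hφ.map_eq]
  rw [integral_map hφ.aemeasurable (by rw [hφ.map_eq]; exact hf.1)]

/-- For fixed second variable `y`, the inner integral is bounded by `GH ≤ (G² + H²) / 2` and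
translation invariance, uniformly in `y`; `F` is integrated last. The two variants below follow by
changes of variables. -/
theorem trilinear_snd {F G H : ℝ → ℝ} (hF : Integrable F) (hF0 : ∀ x, 0 ≤ F x)
    (hG : AEStronglyMeasurable G) (hG2 : Integrable fun x => G x ^ 2) (hG0 : ∀ x, 0 ≤ G x)
    (hH : AEStronglyMeasurable H) (hH2 : Integrable fun x => H x ^ 2) (hH0 : ∀ x, 0 ≤ H x) :
    Integrable (fun z : ℝ × ℝ => F z.2 * (G (z.1 - z.2) * H z.1)) ∧
      ∫ z : ℝ × ℝ, F z.2 * (G (z.1 - z.2) * H z.1)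
        ≤ (∫ x, F x) * (((∫ x, G x ^ 2) + ∫ x, H x ^ 2) / 2) := by
  set Q := ((∫ x, G x ^ 2) + ∫ x, H x ^ 2) / 2 with hQ
  have hmeas : AEStronglyMeasurable (fun z : ℝ × ℝ => F z.2 * (G (z.1 - z.2) * H z.1)) :=
    (hF.1.comp_quasiMeasurePreserving Measure.quasiMeasurePreserving_snd).mul
      ((hG.comp_quasiMeasurePreserving quasiMeasurePreserving_sub).mul
        (hH.comp_quasiMeasurePreserving Measure.quasiMeasurePreserving_fst))
  have hb : ∀ y : ℝ, Integrable (fun x => (G (x - y) ^ 2 + H x ^ 2) / 2) ∧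
      ∫ x, (G (x - y) ^ 2 + H x ^ 2) / 2 = Q := fun y => by
    have h1 : Integrable fun x => G (x - y) ^ 2 := hG2.comp_sub_right y
    refine ⟨(h1.add hH2).div_const 2, ?_⟩
    rw [integral_div, integral_add h1 hH2, integral_sub_right_eq_self (fun x => G x ^ 2)]
  have hle : ∀ x y, G (x - y) * H x ≤ (G (x - y) ^ 2 + H x ^ 2) / 2 := fun x y => by
    nlinarith [sq_nonneg (G (x - y) - H x)]
  have hi : ∀ y, Integrable fun x => G (x - y) * H x := fun y => by
    refine (hb y).1.mono' ((hG.comp_quasiMeasurePreserving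
      (measurePreserving_sub_right volume y).quasiMeasurePreserving).mul hH)
      (ae_of_all _ fun x => ?_)
    rw [Real.norm_of_nonneg (mul_nonneg (hG0 _) (hH0 _))]
    exact hle x y
  have hi' : ∀ y, ∫ x, G (x - y) * H x ≤ Q := fun y => by
    rw [← (hb y).2]
    exact integral_mono (hi y) (hb y).1 fun x => hle x y
  have hnn : ∀ x y, 0 ≤ F y * (G (x - y) * H x) := fun x y =>
    mul_nonneg (hF0 _) (mul_nonneg (hG0 _) (hH0 _))
  have hint : Integrable (fun z : ℝ × ℝ => F z.2 * (G (z.1 - z.2) * H z.1)) := by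
    refine (integrable_prod_iff' hmeas).2 ⟨ae_of_all _ fun y => (hi y).const_mul (F y), ?_⟩
    refine (hF.mul_const Q).mono' hmeas.norm.prod_swap.integral_prod_right' (ae_of_all _ fun y => ?_)
    simp only [Real.norm_of_nonneg (hnn _ _)]
    rw [Real.norm_of_nonneg (integral_nonneg fun x => hnn x y), integral_const_mul]
    exact mul_le_mul_of_nonneg_left (hi' y) (hF0 y)
  refine ⟨hint, ?_⟩
  have e := integral_prod_symm (μ := (volume : Measure ℝ)) (ν := (volume : Measure ℝ)) _ hint
  rw [Measure.volume_eq_prod, e, ← integral_mul_const]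
  refine integral_mono hint.integral_prod_right (hF.mul_const Q) fun y => ?_
  simp only [integral_const_mul]
  exact mul_le_mul_of_nonneg_left (hi' y) (hF0 y)

theorem trilinear_sub {F W : ℝ → ℝ} (hF : Integrable F) (hF0 : ∀ x, 0 ≤ F x)
    (hW : AEStronglyMeasurable W) (hW2 : Integrable fun x => W x ^ 2) (hW0 : ∀ x, 0 ≤ W x) :
    Integrable (fun z : ℝ × ℝ => F (z.1 - z.2) * (W z.2 * W z.1)) ∧
      ∫ z : ℝ × ℝ, F (z.1 - z.2) * (W z.2 * W z.1) ≤ (∫ x, F x) * ∫ x, W x ^ 2 := by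
  obtain ⟨h1, h2⟩ := trilinear_snd hF hF0 hW hW2 hW0 hW hW2 hW0
  have e : (fun z : ℝ × ℝ => F (z.1 - z.2) * (W z.2 * W z.1)) =
      (fun z : ℝ × ℝ => F z.2 * (W (z.1 - z.2) * W z.1)) ∘
        fun z : ℝ × ℝ => (z.1, z.1 - z.2) := by
    ext z; simp
  rw [e]
  refine ⟨measurePreserving_sub_right_coord.integrable_comp_of_integrable h1, ?_⟩
  rw [add_self_div_two] at h2
  exact (MeasurePreserving.integral_comp_of_integrable
    measurePreserving_sub_right_coord h1).trans_le h2

theorem trilinear_fst {F W : ℝ → ℝ} (hF : Integrable F) (hF0 : ∀ x, 0 ≤ F x)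
    (hW : AEStronglyMeasurable W) (hW2 : Integrable fun x => W x ^ 2) (hW0 : ∀ x, 0 ≤ W x) :
    Integrable (fun z : ℝ × ℝ => F z.1 * (W (z.1 - z.2) * W z.2)) ∧
      ∫ z : ℝ × ℝ, F z.1 * (W (z.1 - z.2) * W z.2) ≤ (∫ x, F x) * ∫ x, W x ^ 2 := by
  -- Swapping the variables turns `z.1 - z.2` into its negative, hence the reflected `W`.
  obtain ⟨h1, h2⟩ := trilinear_snd hF hF0 (G := fun x => W (-x))
    (hW.comp_quasiMeasurePreserving
      (Measure.measurePreserving_neg (volume : Measure ℝ)).quasiMeasurePreserving)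
    hW2.comp_neg (fun x => hW0 _) hW hW2 hW0
  have hs : MeasurePreserving (Prod.swap : ℝ × ℝ → ℝ × ℝ) volume volume :=
    Measure.measurePreserving_swap
  have e : (fun z : ℝ × ℝ => F z.1 * (W (z.1 - z.2) * W z.2)) =
      (fun z : ℝ × ℝ => F z.2 * (W (-(z.1 - z.2)) * W z.1)) ∘ Prod.swap := by
    ext z; simp
  rw [e]
  refine ⟨hs.integrable_comp_of_integrable h1, ?_⟩
  rw [integral_neg_eq_self (fun x => W x ^ 2), add_self_div_two] at h2
  exact (MeasurePreserving.integral_comp_of_integrable hs h1).trans_le h2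

/-! ### Symmetrization of the cubic form -/

/-- The inverse of the phase, restricted to the truncated frequencies. -/
def invPhase (p : ℝ → ℝ) (ε : ℝ) : ℝ × ℝ → ℝ :=
  (truncSet ε).indicator fun z => (phase p z.1 z.2)⁻¹

theorem invPhase_swap (p : ℝ → ℝ) (ε a b : ℝ) : invPhase p ε (b, a) = invPhase p ε (a, b) := by
  by_cases h : (a, b) ∈ truncSet ε
  · rw [invPhase, Set.indicator_of_mem h, Set.indicator_of_mem (mem_truncSet_swap.2 h),
      phase_swap]
  · rw [invPhase, Set.indicator_of_notMem h, Set.indicator_of_notMem (mt mem_truncSet_swap.1 h)]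

theorem invPhase_rot {p : ℝ → ℝ} (hp : ∀ ξ, p (-ξ) = p ξ) (ε a b : ℝ) :
    invPhase p ε (-(a + b), b) = invPhase p ε (a, b) := by
  by_cases h : (a, b) ∈ truncSet ε
  · rw [invPhase, Set.indicator_of_mem h, Set.indicator_of_mem (mem_truncSet_rot.2 h),
      phase_rot hp]
  · rw [invPhase, Set.indicator_of_notMem h, Set.indicator_of_notMem (mt mem_truncSet_rot.1 h)]

theorem truncMult_of_mem (p : ℝ → ℝ) {ε a b : ℝ} (h : (a, b) ∈ truncSet ε) :
    truncMult p ε a b = mult p a b := if_pos h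

theorem truncMult_of_notMem (p : ℝ → ℝ) {ε a b : ℝ} (h : (a, b) ∉ truncSet ε) :
    truncMult p ε a b = 0 := if_neg h

theorem truncMult_eq (p : ℝ → ℝ) (ε a b : ℝ) :
    truncMult p ε a b = (a + b) / 2 * invPhase p ε (a, b) := by
  by_cases h : (a, b) ∈ truncSet ε
  · rw [invPhase, Set.indicator_of_mem h, truncMult_of_mem p h, mult]
    change _ / (2 * phase p a b) = _
    rw [div_mul_eq_div_div, div_eq_mul_inv]
  · rw [invPhase, Set.indicator_of_notMem h, truncMult_of_notMem p h, mul_zero]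

theorem measurableSet_truncSet (ε : ℝ) : MeasurableSet (truncSet ε) := by
  have h : ∀ f : ℝ × ℝ → ℝ, Measurable f → MeasurableSet {z | ε < |f z| ∧ |f z| < 1 / ε} :=
    fun f hf => (measurableSet_lt measurable_const hf.abs).inter
      (measurableSet_lt hf.abs measurable_const)
  exact (h _ measurable_fst).inter ((h _ measurable_snd).inter
    (h _ (measurable_fst.add measurable_snd)))

theorem measurable_phase {p : ℝ → ℝ} (hp : Continuous p) :
    Measurable fun z : ℝ × ℝ => phase p z.1 z.2 :=
  (by unfold phase; fun_prop : Continuous fun z : ℝ × ℝ => phase p z.1 z.2).measurable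

theorem measurable_invPhase {p : ℝ → ℝ} (hp : Continuous p) (ε : ℝ) :
    Measurable (invPhase p ε) :=
  (measurable_phase hp).inv.indicator (measurableSet_truncSet ε)

/-- The alternatives for `x` let one bound serve all three monomials of the symmetrization. `K`
depends on `ε` and is used only for integrability. -/
theorem IsSymbol.exists_invPhase_le {p : ℝ → ℝ} {α : ℝ} {j : ℕ}
    (hα : α ∈ Set.Icc (-1 : ℝ) 1) (hj : 1 ≤ j) (hp : IsSymbol p α j) {ε : ℝ} (hε : 0 < ε) (n : ℕ) :
    ∃ K, ∀ a b x, (|x| = |a| ∨ |x| = |b| ∨ |x| = |a + b|) → |x ^ n * invPhase p ε (a, b)| ≤ K := by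
  obtain ⟨δ, hδ, h⟩ := hp.exists_le_phase_of_mem_truncSet hα hj hε
  refine ⟨(1 / ε) ^ n * δ⁻¹, fun a b x hx => ?_⟩
  by_cases hab : (a, b) ∈ truncSet ε
  · rw [invPhase, Set.indicator_of_mem hab, abs_mul, abs_pow, abs_inv]
    have hxε : |x| ≤ 1 / ε := by
      obtain ⟨h1, h2, h3⟩ := hab
      rcases hx with e | e | e <;> rw [e]
      exacts [h1.2.le, h2.2.le, h3.2.le]
    have := h a b hab
    gcongr
  · rw [invPhase, Set.indicator_of_notMem hab, mul_zero, abs_zero]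
    positivity

/-- The cubic expression `v(ξ - η) v(η) conj v(ξ)`. -/
def cubic (v : ℝ → ℂ) (z : ℝ × ℝ) : ℂ := v (z.1 - z.2) * v z.2 * conj (v z.1)

theorem norm_cubic (v : ℝ → ℂ) (z : ℝ × ℝ) :
    ‖cubic v z‖ = ‖v (z.1 - z.2)‖ * (‖v z.2‖ * ‖v z.1‖) := by
  rw [cubic, norm_mul, norm_mul, RCLike.norm_conj, mul_assoc]

theorem aestronglyMeasurable_cubic {v : ℝ → ℂ} (hv : AEStronglyMeasurable v) :
    AEStronglyMeasurable (cubic v) :=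
  ((hv.comp_quasiMeasurePreserving quasiMeasurePreserving_sub).mul
    (hv.comp_quasiMeasurePreserving Measure.quasiMeasurePreserving_snd)).mul
    (Complex.continuous_conj.comp_aestronglyMeasurable
      (hv.comp_quasiMeasurePreserving Measure.quasiMeasurePreserving_fst))

theorem cubic_sub_right (v : ℝ → ℂ) (z : ℝ × ℝ) : cubic v (z.1, z.1 - z.2) = cubic v z := by
  simp only [cubic, sub_sub_cancel]; ring

/-- The map fixes `ξ - η` and exchanges `η` with `-ξ`; since `v(-ξ) = conj (v ξ)`, it only permutes
the factors. -/
theorem cubic_neg_swap {v : ℝ → ℂ} (hv : ∀ᵐ ξ, v (-ξ) = conj (v ξ)) :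
    ∀ᵐ z : ℝ × ℝ, cubic v (-z.2, -z.1) = cubic v z := by
  filter_upwards [Measure.quasiMeasurePreserving_fst.ae hv,
    Measure.quasiMeasurePreserving_snd.ae hv] with z h1 h2
  simp only [cubic, h1, h2, Complex.conj_conj, show -z.2 - -z.1 = z.1 - z.2 by ring]
  ring

theorem integrable_cubic {v : ℝ → ℂ} (hv : MemLp v 2) (hv1 : Integrable v) :
    Integrable (cubic v) := by
  have h := (trilinear_sub hv1.norm (fun x => norm_nonneg _) hv.1.norm
    ((memLp_two_iff_integrable_sq_norm hv.1).1 hv) (fun x => norm_nonneg _)).1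
  refine h.mono' (aestronglyMeasurable_cubic hv.1) (ae_of_all _ fun z => ?_)
  rw [norm_cubic]

/-- The substitution `η ↦ ξ - η` exchanges the monomials in `ξ - η` and `η`, and `(ξ, η) ↦ (-η, -ξ)`
turns the one in `ξ` into minus the one in `η`, the power being odd. The three integrals thus agree
up to sign; the truncation makes each of them converge. -/
theorem integral_symmetrize {p : ℝ → ℝ} {α : ℝ} {j : ℕ} (hα : α ∈ Set.Icc (-1 : ℝ) 1)
    (hj : 1 ≤ j) (hp : IsSymbol p α j) {v : ℝ → ℂ} (hv : MemLp v 2) (hv1 : Integrable v)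
    (hneg : ∀ᵐ ξ, v (-ξ) = conj (v ξ)) {ε : ℝ} (hε : 0 < ε) (k : ℕ) :
    ∫ z : ℝ × ℝ, ((z.1 ^ (2 * k + 1) * invPhase p ε (z.1 - z.2, z.2) : ℝ) : ℂ) * cubic v z =
      -(1 / 3) * ∫ z : ℝ × ℝ, ((((z.1 - z.2) ^ (2 * k + 1) + z.2 ^ (2 * k + 1) -
        z.1 ^ (2 * k + 1)) * invPhase p ε (z.1 - z.2, z.2) : ℝ) : ℂ) * cubic v z := by
  have hodd : Odd (2 * k + 1) := ⟨k, rfl⟩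
  obtain ⟨K, hK⟩ := hp.exists_invPhase_le hα hj hε (2 * k + 1)
  have hΦ := integrable_cubic hv hv1
  have hR : Measurable fun z : ℝ × ℝ => invPhase p ε (z.1 - z.2, z.2) :=
    (measurable_invPhase hp.contDiff.continuous ε).comp
      ((measurable_fst.sub measurable_snd).prodMk measurable_snd)
  have hint : ∀ x : ℝ × ℝ → ℝ, Measurable x →
      (∀ z, |x z| = |z.1 - z.2| ∨ |x z| = |z.2| ∨ |x z| = |z.1 - z.2 + z.2|) →
      Integrable fun z : ℝ × ℝ =>
        ((x z ^ (2 * k + 1) * invPhase p ε (z.1 - z.2, z.2) : ℝ) : ℂ) * cubic v z := by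
    intro x hx hx'
    refine hΦ.bdd_mul (c := K)
      (Complex.measurable_ofReal.comp ((hx.pow_const _).mul hR)).aestronglyMeasurable
      (ae_of_all _ fun z => ?_)
    rw [Complex.norm_real, Real.norm_eq_abs]
    exact hK _ _ _ (hx' z)
  have h1 := hint (fun z => z.1) measurable_fst fun z => by simp
  have h2 := hint (fun z => z.2) measurable_snd fun z => by simp
  have h3 := hint (fun z => z.1 - z.2) (measurable_fst.sub measurable_snd) fun z => by simp
  have e1 : ∫ z : ℝ × ℝ, (((z.1 - z.2) ^ (2 * k + 1) * invPhase p ε (z.1 - z.2, z.2) : ℝ) : ℂ)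
        * cubic v z
      = ∫ z : ℝ × ℝ, ((z.2 ^ (2 * k + 1) * invPhase p ε (z.1 - z.2, z.2) : ℝ) : ℂ)
        * cubic v z := by
    rw [← MeasurePreserving.integral_comp_of_integrable measurePreserving_sub_right_coord h2]
    congr 1
    ext z
    dsimp only
    rw [cubic_sub_right, sub_sub_cancel, invPhase_swap]
  have e2 : ∫ z : ℝ × ℝ, ((z.1 ^ (2 * k + 1) * invPhase p ε (z.1 - z.2, z.2) : ℝ) : ℂ)
        * cubic v z
      = -∫ z : ℝ × ℝ, ((z.2 ^ (2 * k + 1) * invPhase p ε (z.1 - z.2, z.2) : ℝ) : ℂ)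
        * cubic v z := by
    rw [← MeasurePreserving.integral_comp_of_integrable measurePreserving_neg_swap h1,
      ← integral_neg]
    refine integral_congr_ae ?_
    filter_upwards [cubic_neg_swap hneg] with z hz
    have e := invPhase_rot hp.even ε z.2 (z.1 - z.2)
    rw [add_sub_cancel, invPhase_swap] at e
    rw [hz, hodd.neg_pow, show -z.2 - -z.1 = z.1 - z.2 by ring, e, invPhase_swap]
    push_cast
    ring
  have e3 : ∀ z : ℝ × ℝ, ((((z.1 - z.2) ^ (2 * k + 1) + z.2 ^ (2 * k + 1) -
        z.1 ^ (2 * k + 1)) * invPhase p ε (z.1 - z.2, z.2) : ℝ) : ℂ) * cubic v z =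
      (((z.1 - z.2) ^ (2 * k + 1) * invPhase p ε (z.1 - z.2, z.2) : ℝ) : ℂ) * cubic v z +
      ((z.2 ^ (2 * k + 1) * invPhase p ε (z.1 - z.2, z.2) : ℝ) : ℂ) * cubic v z -
      ((z.1 ^ (2 * k + 1) * invPhase p ε (z.1 - z.2, z.2) : ℝ) : ℂ) * cubic v z := fun z => by
    push_cast; ring
  simp_rw [e3]
  have e4 := integral_sub (h3.add h2) h1
  rw [integral_add' h3 h2] at e4
  simp only [Pi.add_apply] at e4
  rw [e4, e1, e2]
  ring

/-- The integrand of `(∂ₓᵏ u, ∂ₓᵏ B(u, u))₂` on the Fourier side. -/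
def cubicIntegrand (μ : ℝ → ℝ → ℝ) (k : ℕ) (v : ℝ → ℂ) (z : ℝ × ℝ) : ℂ :=
  (z.1 : ℂ) ^ (2 * k) * conj (v z.1) * ((μ (z.1 - z.2) z.2 : ℂ) * v (z.1 - z.2) * v z.2)

theorem cubicIntegrand_truncMult (p : ℝ → ℝ) (ε : ℝ) (k : ℕ) (v : ℝ → ℂ) (z : ℝ × ℝ) :
    cubicIntegrand (truncMult p ε) k v z =
      1 / 2 * (((z.1 ^ (2 * k + 1) * invPhase p ε (z.1 - z.2, z.2) : ℝ) : ℂ) * cubic v z) := by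
  rw [cubicIntegrand, truncMult_eq, cubic, sub_add_cancel]
  push_cast
  ring

theorem integrable_cubicIntegrand_truncMult {p : ℝ → ℝ} {α : ℝ} {j : ℕ}
    (hα : α ∈ Set.Icc (-1 : ℝ) 1) (hj : 1 ≤ j) (hp : IsSymbol p α j) {v : ℝ → ℂ}
    (hv : MemLp v 2) (hv1 : Integrable v) {ε : ℝ} (hε : 0 < ε) (k : ℕ) :
    Integrable (cubicIntegrand (truncMult p ε) k v) := by
  obtain ⟨K, hK⟩ := hp.exists_invPhase_le hα hj hε (2 * k + 1)
  have hR : Measurable fun z : ℝ × ℝ => invPhase p ε (z.1 - z.2, z.2) :=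
    (measurable_invPhase hp.contDiff.continuous ε).comp
      ((measurable_fst.sub measurable_snd).prodMk measurable_snd)
  rw [funext (cubicIntegrand_truncMult p ε k v)]
  refine ((integrable_cubic hv hv1).bdd_mul (c := K)
    (Complex.measurable_ofReal.comp ((measurable_fst.pow_const _).mul hR)).aestronglyMeasurable
    (ae_of_all _ fun z => ?_)).const_mul _
  rw [Function.comp_apply, Complex.norm_real, Real.norm_eq_abs]
  exact hK _ _ _ (by simp)

theorem eventually_mem_truncSet {a b : ℝ} (ha : a ≠ 0) (hb : b ≠ 0) (hab : a + b ≠ 0) :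
    ∀ᶠ ε in 𝓝[>] (0 : ℝ), (a, b) ∈ truncSet ε := by
  have h : ∀ x : ℝ, x ≠ 0 → ∀ᶠ ε in 𝓝[>] (0 : ℝ), ε < |x| ∧ |x| < 1 / ε := fun x hx => by
    have hx' := abs_pos.2 hx
    filter_upwards [Ioo_mem_nhdsGT hx', Ioo_mem_nhdsGT (inv_pos.2 hx')] with ε h1 h2
    refine ⟨h1.2, ?_⟩
    rw [one_div]
    exact (lt_inv_comm₀ h1.1 hx').1 h2.2
  filter_upwards [h a ha, h b hb, h _ hab] with ε h1 h2 h3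
  exact ⟨h1, h2, h3⟩

/-- The weighted cubic integral is controlled by an `L¹` norm times the square of an `L²` norm. -/
theorem integral_triWeight_le {v : ℝ → ℂ} (k : ℕ) (hv : AEStronglyMeasurable v)
    (h1 : Integrable fun x => (1 + |x|) * ‖v x‖)
    (h2 : Integrable fun x => ((1 + |x|) ^ k * ‖v x‖) ^ 2) :
    Integrable (fun z : ℝ × ℝ => triWeight k (z.1 - z.2) z.2 * ‖cubic v z‖) ∧
      ∫ z : ℝ × ℝ, triWeight k (z.1 - z.2) z.2 * ‖cubic v z‖ ≤
        3 * ((∫ x, (1 + |x|) * ‖v x‖) * ∫ x, ((1 + |x|) ^ k * ‖v x‖) ^ 2) := by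
  have hW : AEStronglyMeasurable fun x => (1 + |x|) ^ k * ‖v x‖ :=
    (by fun_prop : Continuous fun x : ℝ => (1 + |x|) ^ k).aestronglyMeasurable.mul hv.norm
  have hF0 : ∀ x, 0 ≤ (1 + |x|) * ‖v x‖ := fun x => by positivity
  have hW0 : ∀ x, 0 ≤ (1 + |x|) ^ k * ‖v x‖ := fun x => by positivity
  obtain ⟨i1, b1⟩ := trilinear_snd h1 hF0 hW h2 hW0 hW h2 hW0
  obtain ⟨i2, b2⟩ := trilinear_sub h1 hF0 hW h2 hW0
  obtain ⟨i3, b3⟩ := trilinear_fst h1 hF0 hW h2 hW0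
  rw [add_self_div_two] at b1
  have e : (fun z : ℝ × ℝ => triWeight k (z.1 - z.2) z.2 * ‖cubic v z‖) = fun z =>
      (1 + |z.1 - z.2|) * ‖v (z.1 - z.2)‖ *
        ((1 + |z.2|) ^ k * ‖v z.2‖ * ((1 + |z.1|) ^ k * ‖v z.1‖)) +
      (1 + |z.2|) * ‖v z.2‖ *
        ((1 + |z.1 - z.2|) ^ k * ‖v (z.1 - z.2)‖ * ((1 + |z.1|) ^ k * ‖v z.1‖)) +
      (1 + |z.1|) * ‖v z.1‖ *
        ((1 + |z.1 - z.2|) ^ k * ‖v (z.1 - z.2)‖ * ((1 + |z.2|) ^ k * ‖v z.2‖)) := by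
    ext z
    rw [norm_cubic, triWeight, sub_add_cancel]
    ring
  rw [e]
  refine ⟨(i2.add i1).add i3, ?_⟩
  have e4 := integral_add (i2.add i1) i3
  rw [integral_add' i2 i1] at e4
  simp only [Pi.add_apply] at e4
  rw [e4]
  linarith

/-- The limit of the truncated cubic forms. -/
theorem tendsto_integral_truncMult {p : ℝ → ℝ} {α : ℝ} {j : ℕ} (hα : α ∈ Set.Icc (-1 : ℝ) 1)
    (hj : 1 ≤ j) (hp : IsSymbol p α j) {v : ℝ → ℂ} (hv : MemLp v 2) (hv1 : Integrable v)
    (hneg : ∀ᵐ ξ, v (-ξ) = conj (v ξ)) {k : ℕ} (hk : j ≤ k)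
    (h1 : Integrable fun x => (1 + |x|) * ‖v x‖)
    (h2 : Integrable fun x => ((1 + |x|) ^ k * ‖v x‖) ^ 2) :
    Tendsto (fun ε => ∫ z, cubicIntegrand (truncMult p ε) k v z) (𝓝[>] (0 : ℝ))
      (𝓝 (-(1 / 6) * ∫ z : ℝ × ℝ, (symMult p k (z.1 - z.2) z.2 : ℂ) * cubic v z)) := by
  have hodd : Odd (2 * k + 1) := ⟨k, rfl⟩
  obtain ⟨C, hC, hS⟩ := hp.symMult_le hα hj hk
  have hw := (integral_triWeight_le k hv.1 h1 h2).1
  have hΦ := aestronglyMeasurable_cubic hv.1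
  have hR : ∀ ε, Measurable fun z : ℝ × ℝ => invPhase p ε (z.1 - z.2, z.2) := fun ε =>
    (measurable_invPhase hp.contDiff.continuous ε).comp
      ((measurable_fst.sub measurable_snd).prodMk measurable_snd)
  have hSe : ∀ ε a b, (a, b) ∈ truncSet ε →
      (a ^ (2 * k + 1) + b ^ (2 * k + 1) - (a + b) ^ (2 * k + 1)) * invPhase p ε (a, b) =
        symMult p k a b := fun ε a b h => by
    rw [invPhase, Set.indicator_of_mem h, symMult, div_eq_mul_inv]
  have hlim : Tendsto (fun ε => ∫ z : ℝ × ℝ, ((((z.1 - z.2) ^ (2 * k + 1) + z.2 ^ (2 * k + 1) -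
        z.1 ^ (2 * k + 1)) * invPhase p ε (z.1 - z.2, z.2) : ℝ) : ℂ) * cubic v z) (𝓝[>] (0 : ℝ))
      (𝓝 (∫ z : ℝ × ℝ, (symMult p k (z.1 - z.2) z.2 : ℂ) * cubic v z)) := by
    refine tendsto_integral_filter_of_dominated_convergence
      (fun z : ℝ × ℝ => C * (triWeight k (z.1 - z.2) z.2 * ‖cubic v z‖))
      (Eventually.of_forall fun ε => ?_) (Eventually.of_forall fun ε => ae_of_all _ fun z => ?_)
      (hw.const_mul C) (ae_of_all _ fun z => ?_)
    · exact (Complex.measurable_ofReal.comp ((by fun_prop : Measurable fun z : ℝ × ℝ =>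
        (z.1 - z.2) ^ (2 * k + 1) + z.2 ^ (2 * k + 1) - z.1 ^ (2 * k + 1)).mul
        (hR ε))).aestronglyMeasurable.mul hΦ
    · rw [norm_mul, Complex.norm_real, Real.norm_eq_abs, ← mul_assoc]
      gcongr
      have h0 := hS (z.1 - z.2) z.2
      by_cases h : (z.1 - z.2, z.2) ∈ truncSet ε
      · have e := hSe ε _ _ h
        rw [sub_add_cancel] at e
        rwa [e]
      · rw [invPhase, Set.indicator_of_notMem h, mul_zero, abs_zero]
        exact (abs_nonneg _).trans h0
    · refine Tendsto.mul_const _ ((Complex.continuous_ofReal.tendsto _).comp ?_)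
      -- Off the three degenerate lines the integrand is eventually constant in `ε`; on them the
      -- numerator vanishes.
      by_cases h : z.1 - z.2 ≠ 0 ∧ z.2 ≠ 0 ∧ z.1 - z.2 + z.2 ≠ 0
      · refine tendsto_const_nhds.congr' ?_
        filter_upwards [eventually_mem_truncSet h.1 h.2.1 h.2.2] with ε hε
        have e := hSe ε _ _ hε
        rw [sub_add_cancel] at e
        exact e.symm
      · have hz : (z.1 - z.2) ^ (2 * k + 1) + z.2 ^ (2 * k + 1) - z.1 ^ (2 * k + 1) = 0 := by
          rw [sub_add_cancel] at h
          by_cases ha : z.1 - z.2 = 0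
          · rw [ha, sub_eq_zero.1 ha]; simp
          by_cases hb : z.2 = 0
          · rw [hb]; simp
          · have hc : z.1 = 0 := by tauto
            rw [hc, zero_sub, hodd.neg_pow]; simp
        simp only [symMult, sub_add_cancel, hz, zero_mul, zero_div]
        exact tendsto_const_nhds
  -- The factor `1/2` is that of `m`, and `-(1/3)` comes from the symmetrization.
  have e : -(1 / 6 : ℂ) * ∫ z : ℝ × ℝ, (symMult p k (z.1 - z.2) z.2 : ℂ) * cubic v z =
      1 / 2 * (-(1 / 3) * ∫ z : ℝ × ℝ, (symMult p k (z.1 - z.2) z.2 : ℂ) * cubic v z) := by ring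
  rw [e]
  refine ((hlim.const_mul (-(1 / 3))).const_mul (1 / 2)).congr' ?_
  filter_upwards [self_mem_nhdsWithin] with ε hε
  simp_rw [cubicIntegrand_truncMult]
  rw [integral_const_mul, integral_symmetrize hα hj hp hv hv1 hneg hε]

/-- If the cubic form converges absolutely, then it is the limit of the truncated forms. -/
theorem tendsto_integral_truncMult_of_integrable {p : ℝ → ℝ} (hp : Continuous p) {v : ℝ → ℂ}
    (hv : AEStronglyMeasurable v) {k : ℕ} (h : Integrable (cubicIntegrand (mult p) k v)) :
    Tendsto (fun ε => ∫ z, cubicIntegrand (truncMult p ε) k v z) (𝓝[>] (0 : ℝ))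
      (𝓝 (∫ z, cubicIntegrand (mult p) k v z)) := by
  have hR : ∀ ε, Measurable fun z : ℝ × ℝ => invPhase p ε (z.1 - z.2, z.2) := fun ε =>
    (measurable_invPhase hp ε).comp
      ((measurable_fst.sub measurable_snd).prodMk measurable_snd)
  have h0 : ∀ᵐ x : ℝ, x ≠ 0 := Measure.ae_ne volume 0
  refine tendsto_integral_filter_of_dominated_convergence
    (fun z => ‖cubicIntegrand (mult p) k v z‖) (Eventually.of_forall fun ε => ?_)
    (Eventually.of_forall fun ε => ae_of_all _ fun z => ?_) h.norm ?_
  · rw [funext (cubicIntegrand_truncMult p ε k v)]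
    exact ((Complex.measurable_ofReal.comp ((measurable_fst.pow_const _).mul
      (hR ε))).aestronglyMeasurable.mul (aestronglyMeasurable_cubic hv)).const_mul _
  · by_cases hz : (z.1 - z.2, z.2) ∈ truncSet ε
    · rw [cubicIntegrand, truncMult_of_mem p hz, cubicIntegrand]
    · rw [cubicIntegrand, truncMult_of_notMem p hz]
      simp
  · filter_upwards [Measure.quasiMeasurePreserving_fst.ae h0,
      Measure.quasiMeasurePreserving_snd.ae h0, quasiMeasurePreserving_sub.ae h0] with z h1 h2 h3
    refine tendsto_const_nhds.congr' ?_
    filter_upwards [eventually_mem_truncSet h3 h2 (by rwa [sub_add_cancel])] with ε hz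
    rw [cubicIntegrand, cubicIntegrand, truncMult_of_mem p hz]

/-! ### Sobolev norms on the Fourier side -/

theorem memLp_weight_hat_of_le {N k : ℕ} (hk : k ≤ N) {u : L2} (hu : IsRealSobolev N u) :
    MemLp (fun ξ => (((1 + |ξ|) ^ k : ℝ) : ℂ) * hat u ξ) 2 volume := by
  refine (memLp_weight_hat hu.2).of_le ((by fun_prop : Continuous fun ξ : ℝ =>
    (((1 + |ξ|) ^ k : ℝ) : ℂ)).aestronglyMeasurable.mul (memLp_hat u).1) (ae_of_all _ fun ξ => ?_)
  rw [norm_mul, norm_mul, Complex.norm_real, Complex.norm_real,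
    Real.norm_of_nonneg (by positivity), Real.norm_of_nonneg (by positivity)]
  gcongr
  linarith [abs_nonneg ξ]

theorem memLp_mul_pow_hat {N k : ℕ} (hk : k ≤ N) {u : L2} (hu : IsRealSobolev N u) :
    MemLp (fun ξ : ℝ => (Complex.I * ξ) ^ k * hat u ξ) 2 volume := by
  refine (memLp_weight_hat_of_le hk hu).of_le ((by fun_prop : Continuous fun ξ : ℝ =>
    (Complex.I * ξ) ^ k).aestronglyMeasurable.mul (memLp_hat u).1) (ae_of_all _ fun ξ => ?_)
  rw [norm_mul, norm_mul, Complex.norm_real, Real.norm_of_nonneg (by positivity), norm_pow,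
    norm_mul, Complex.norm_I, one_mul, Complex.norm_real, Real.norm_eq_abs]
  gcongr
  linarith [abs_nonneg ξ]

theorem integrable_weight_sq {N k : ℕ} (hk : k ≤ N) {u : L2} (hu : IsRealSobolev N u) :
    Integrable fun ξ => ((1 + |ξ|) ^ k * ‖hat u ξ‖) ^ 2 := by
  have h := memLp_weight_hat_of_le hk hu
  refine ((memLp_two_iff_integrable_sq_norm h.1).1 h).congr (ae_of_all _ fun ξ => ?_)
  simp only [norm_mul, Complex.norm_real, Real.norm_of_nonneg (by positivity : 0 ≤ (1 + |ξ|) ^ k)]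

theorem norm_dx_sq {N k : ℕ} (hk : k ≤ N) {u : L2} (hu : IsRealSobolev N u) :
    Integrable (fun ξ => |ξ| ^ (2 * k) * ‖hat u ξ‖ ^ 2) ∧
      ‖dx k u‖ ^ 2 = (2 * Real.pi)⁻¹ * ∫ ξ, |ξ| ^ (2 * k) * ‖hat u ξ‖ ^ 2 := by
  have h := memLp_mul_pow_hat hk hu
  have e : ∀ ξ : ℝ, ‖(Complex.I * ξ) ^ k * hat u ξ‖ ^ 2 = |ξ| ^ (2 * k) * ‖hat u ξ‖ ^ 2 :=
    fun ξ => by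
      rw [norm_mul, norm_pow, norm_mul, Complex.norm_I, one_mul, Complex.norm_real,
        Real.norm_eq_abs, mul_pow, ← pow_mul, mul_comm k]
  refine ⟨((memLp_two_iff_integrable_sq_norm h.1).1 h).congr (ae_of_all _ e), ?_⟩
  rw [norm_sq_eq_integral_hat, dx]
  congr 1
  refine integral_congr_ae ?_
  filter_upwards [hat_ofHat h] with ξ hξ
  rw [hξ, e]

/-- Since `(1+|ξ|) ^ (2k) ≤ 4 ^ k (1 + |ξ| ^ (2k))`, only the orders `0` and `k` appear, so the norm
without intermediate derivatives suffices. -/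
theorem integral_weight_sq_le {N k : ℕ} (hk : k ≤ N) {u : L2} (hu : IsRealSobolev N u) :
    ∫ ξ, ((1 + |ξ|) ^ k * ‖hat u ξ‖) ^ 2 ≤
      4 ^ k * (2 * Real.pi) * (‖u‖ ^ 2 + ‖dx k u‖ ^ 2) := by
  obtain ⟨h1, h2⟩ := norm_dx_sq hk hu
  have h0 : Integrable fun ξ => ‖hat u ξ‖ ^ 2 :=
    (memLp_two_iff_integrable_sq_norm (memLp_hat u).1).1 (memLp_hat u)
  calc ∫ ξ, ((1 + |ξ|) ^ k * ‖hat u ξ‖) ^ 2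
      ≤ ∫ ξ, 4 ^ k * (‖hat u ξ‖ ^ 2 + |ξ| ^ (2 * k) * ‖hat u ξ‖ ^ 2) := by
        refine integral_mono (integrable_weight_sq hk hu) ((h0.add h1).const_mul _) fun ξ => ?_
        have hw : (1 + |ξ|) ^ (2 * k) ≤ 4 ^ k * (1 + |ξ| ^ (2 * k)) := by
          have h4 : (4 : ℝ) ^ k = 2 ^ (2 * k) := by rw [pow_mul]; norm_num
          rw [h4]
          rcases le_total |ξ| 1 with h | h
          · calc (1 + |ξ|) ^ (2 * k) ≤ 2 ^ (2 * k) := by gcongr; linarith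
              _ ≤ _ := le_mul_of_one_le_right (by positivity) (by
                have : 0 ≤ |ξ| ^ (2 * k) := by positivity
                linarith)
          · calc (1 + |ξ|) ^ (2 * k) ≤ (2 * |ξ|) ^ (2 * k) := by gcongr; linarith
              _ = 2 ^ (2 * k) * |ξ| ^ (2 * k) := mul_pow _ _ _
              _ ≤ _ := by gcongr; linarith
        calc ((1 + |ξ|) ^ k * ‖hat u ξ‖) ^ 2 = (1 + |ξ|) ^ (2 * k) * ‖hat u ξ‖ ^ 2 := by
              rw [mul_pow, ← pow_mul, mul_comm k]
          _ ≤ 4 ^ k * (1 + |ξ| ^ (2 * k)) * ‖hat u ξ‖ ^ 2 := by gcongr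
          _ = _ := by ring
    _ = 4 ^ k * (2 * Real.pi) * (‖u‖ ^ 2 + ‖dx k u‖ ^ 2) := by
        rw [integral_const_mul, integral_add h0 h1, h2, norm_sq_eq_integral_hat u]
        field_simp

theorem norm_dx_sq_le {N k : ℕ} (hk : k ≤ N) {u : L2} (hu : IsRealSobolev N u) :
    ‖dx k u‖ ^ 2 ≤ ‖u‖ ^ 2 + ‖dx N u‖ ^ 2 := by
  obtain ⟨h1, h2⟩ := norm_dx_sq hk hu
  obtain ⟨h3, h4⟩ := norm_dx_sq le_rfl hu
  have h0 : Integrable fun ξ => ‖hat u ξ‖ ^ 2 :=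
    (memLp_two_iff_integrable_sq_norm (memLp_hat u).1).1 (memLp_hat u)
  rw [h2, h4, norm_sq_eq_integral_hat u, ← mul_add, ← integral_add h0 h3]
  gcongr ?_ * ?_
  refine integral_mono h1 (h0.add h3) fun ξ => ?_
  have hw : |ξ| ^ (2 * k) ≤ 1 + |ξ| ^ (2 * N) := by
    rcases le_total |ξ| 1 with h | h
    · have := pow_le_one₀ (n := 2 * k) (abs_nonneg ξ) h
      have : 0 ≤ |ξ| ^ (2 * N) := by positivity
      linarith
    · have := pow_le_pow_right₀ h (by omega : 2 * k ≤ 2 * N)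
      linarith
  calc |ξ| ^ (2 * k) * ‖hat u ξ‖ ^ 2 ≤ (1 + |ξ| ^ (2 * N)) * ‖hat u ξ‖ ^ 2 := by gcongr
    _ = _ := by ring

theorem norm_dx_zero {N : ℕ} {u : L2} (hu : IsRealSobolev N u) : ‖dx 0 u‖ ^ 2 = ‖u‖ ^ 2 := by
  rw [(norm_dx_sq N.zero_le hu).2, norm_sq_eq_integral_hat u]
  simp

theorem sobolevNorm_sq (N : ℕ) (u : L2) :
    sobolevNorm N u ^ 2 = ∑ k ∈ Finset.range (N + 1), ‖dx k u‖ ^ 2 :=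
  Real.sq_sqrt (Finset.sum_nonneg fun _ _ => by positivity)

theorem energyNorm_sq (j N : ℕ) (u : L2) :
    energyNorm j N u ^ 2 = ‖u‖ ^ 2 + ∑ k ∈ Finset.Icc (2 * j - 1) N, ‖dx k u‖ ^ 2 :=
  Real.sq_sqrt (add_nonneg (by positivity) (Finset.sum_nonneg fun _ _ => by positivity))

theorem add_norm_dx_sq_le_energyNorm_sq {j N k : ℕ} (hk : k ∈ Finset.Icc (2 * j - 1) N) (u : L2) :
    ‖u‖ ^ 2 + ‖dx k u‖ ^ 2 ≤ energyNorm j N u ^ 2 := by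
  rw [energyNorm_sq]
  gcongr
  exact Finset.single_le_sum (f := fun k => ‖dx k u‖ ^ 2) (fun _ _ => by positivity) hk

theorem energyNorm_le_sobolevNorm {j N : ℕ} (hj : 1 ≤ j) {u : L2} (hu : IsRealSobolev N u) :
    energyNorm j N u ≤ sobolevNorm N u := by
  refine Real.sqrt_le_sqrt ?_
  rw [Finset.sum_range_succ', norm_dx_zero hu, add_comm]
  gcongr
  -- The order `0` has been split off as `‖u‖²`; since `2j - 1 ≥ 1`, the other orders in the energy
  -- norm are all shifted indices.
  rw [← Finset.sum_image (f := fun k => ‖dx k u‖ ^ 2) (g := fun k => k + 1)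
    (fun a _ b _ h => Nat.succ_injective h)]
  refine Finset.sum_le_sum_of_subset_of_nonneg (fun k hk => ?_) fun _ _ _ => by positivity
  have := Finset.mem_Icc.1 hk
  exact Finset.mem_image.2 ⟨k - 1, Finset.mem_range.2 (by omega), by omega⟩

theorem sobolevNorm_le_energyNorm {j N : ℕ} (hN : 2 * j - 1 ≤ N) {u : L2}
    (hu : IsRealSobolev N u) : sobolevNorm N u ≤ (N + 1) * energyNorm j N u := by
  have h0 : 0 ≤ energyNorm j N u := Real.sqrt_nonneg _
  refine abs_le_of_sq_le_sq' ?_ (by positivity) |>.2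
  have hE := add_norm_dx_sq_le_energyNorm_sq (Finset.mem_Icc.2 ⟨hN, le_rfl⟩) u
  rw [sobolevNorm_sq]
  calc ∑ k ∈ Finset.range (N + 1), ‖dx k u‖ ^ 2
      ≤ ∑ k ∈ Finset.range (N + 1), energyNorm j N u ^ 2 :=
        Finset.sum_le_sum fun k hk =>
          (norm_dx_sq_le (Nat.lt_succ_iff.1 (Finset.mem_range.1 hk)) hu).trans hE
    _ = (N + 1) * energyNorm j N u ^ 2 := by simp
    -- The sharper factor `√(N + 1)` is replaced by `N + 1`.
    _ ≤ ((N + 1) * energyNorm j N u) ^ 2 := by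
        rw [mul_pow]
        gcongr
        have : (0 : ℝ) ≤ N := N.cast_nonneg
        nlinarith

/-- The Fourier transform of `u ∈ H²` is integrable with weight `1 + |ξ|`. -/
theorem exists_integral_weight_le :
    ∃ C > 0, ∀ (N : ℕ) (_ : 2 ≤ N) (u : L2), IsRealSobolev N u →
      Integrable (fun ξ => (1 + |ξ|) * ‖hat u ξ‖) ∧
        ∫ ξ, (1 + |ξ|) * ‖hat u ξ‖ ≤ C * sobolevNorm 2 u := by
  -- Cauchy–Schwarz is applied to `1 + |ξ| = (1+|ξ|)⁻¹ (1+|ξ|)²`, which is why the `H²` norm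
  -- appears. The `+ 1` in the constant below only makes it visibly positive.
  have hd : MemLp (fun ξ : ℝ => (1 + |ξ|)⁻¹) 2 volume := by
    have hc : Continuous fun ξ : ℝ => (1 + |ξ|)⁻¹ :=
      (by fun_prop : Continuous fun ξ : ℝ => 1 + |ξ|).inv₀ fun ξ => by positivity
    rw [memLp_two_iff_integrable_sq hc.aestronglyMeasurable]
    refine (integrable_one_add_norm (E := ℝ) (μ := volume) (r := 2) (by simp)).congr
      (ae_of_all _ fun ξ => ?_)
    simp only [Real.norm_eq_abs]
    rw [Real.rpow_neg (by positivity), Real.rpow_two, inv_pow]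
  refine ⟨√(∫ ξ : ℝ, ((1 + |ξ|)⁻¹) ^ 2) * √(4 ^ 2 * (2 * Real.pi)) + 1, by positivity,
    fun N hN u hu => ?_⟩
  have hW := integrable_weight_sq hN hu
  have hWm : AEStronglyMeasurable fun ξ => (1 + |ξ|) ^ 2 * ‖hat u ξ‖ :=
    (by fun_prop : Continuous fun x : ℝ => (1 + |x|) ^ 2).aestronglyMeasurable.mul
      (memLp_hat u).1.norm
  have hW2 : MemLp (fun ξ => (1 + |ξ|) ^ 2 * ‖hat u ξ‖) 2 volume :=
    (memLp_two_iff_integrable_sq hWm).2 hW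
  have e : ∀ ξ : ℝ, (1 + |ξ|)⁻¹ * ((1 + |ξ|) ^ 2 * ‖hat u ξ‖) = (1 + |ξ|) * ‖hat u ξ‖ :=
    fun ξ => by field_simp
  refine ⟨(hd.integrable_mul hW2).congr (ae_of_all _ e), ?_⟩
  have h := integral_mul_le_Lp_mul_Lq_of_nonneg (μ := volume) Real.HolderConjugate.two_two
    (ae_of_all _ fun ξ : ℝ => (by positivity : 0 ≤ (1 + |ξ|)⁻¹))
    (ae_of_all _ fun ξ : ℝ => (by positivity : 0 ≤ (1 + |ξ|) ^ 2 * ‖hat u ξ‖))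
    (by simpa using hd) (by simpa using hW2)
  simp only [e, Real.rpow_two, ← Real.sqrt_eq_rpow] at h
  have hs : √(∫ ξ, ((1 + |ξ|) ^ 2 * ‖hat u ξ‖) ^ 2) ≤
      √(4 ^ 2 * (2 * Real.pi)) * sobolevNorm 2 u := by
    rw [sobolevNorm, ← Real.sqrt_mul (by positivity)]
    refine Real.sqrt_le_sqrt ((integral_weight_sq_le hN hu).trans ?_)
    gcongr
    rw [← norm_dx_zero hu]
    simp only [Finset.sum_range_succ, Finset.sum_range_zero]
    have : 0 ≤ ‖dx 1 u‖ ^ 2 := by positivity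
    linarith
  have h0 : 0 ≤ sobolevNorm 2 u := Real.sqrt_nonneg _
  calc _ ≤ _ := h
    _ ≤ √(∫ ξ : ℝ, ((1 + |ξ|)⁻¹) ^ 2) * (√(4 ^ 2 * (2 * Real.pi)) * sobolevNorm 2 u) := by gcongr
    _ ≤ _ := by linarith

/-! ### The modified energies -/

/-- The energy as an integral over the frequencies. -/
theorem energyWith_eq {μ : ℝ → ℝ → ℝ} {N k : ℕ} (hk : k ≤ N) {u : L2} (hu : IsRealSobolev N u)
    (h1 : MemLp (pseudoHat μ u u) 2 volume)
    (h2 : MemLp (fun ξ : ℝ => (Complex.I * ξ) ^ k * pseudoHat μ u u ξ) 2 volume)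
    (h3 : Integrable (cubicIntegrand μ k (hat u))) :
    energyWith μ k u =
      ‖dx k u‖ ^ 2 + Real.pi⁻¹ * (∫ z, cubicIntegrand μ k (hat u) z).re := by
  have hB := hat_ofHat h1
  have h2' : MemLp (fun ξ : ℝ => (Complex.I * ξ) ^ k * hat (pseudoProd μ u u) ξ) 2 volume := by
    refine h2.ae_eq ?_
    filter_upwards [hB] with ξ hξ
    rw [pseudoProd, hξ]
  have hI : inner ℂ (dx k u) (dx k (pseudoProd μ u u)) =
      ((2 * Real.pi)⁻¹ : ℝ) * ∫ z, cubicIntegrand μ k (hat u) z := by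
    rw [inner_eq_integral_hat, Measure.volume_eq_prod, integral_prod _ h3]
    congr 1
    refine integral_congr_ae ?_
    filter_upwards [hB, hat_ofHat h2', hat_ofHat (memLp_mul_pow_hat hk hu)] with ξ e1 e2 e3
    simp only [dx, e2, e3, cubicIntegrand, integral_const_mul]
    rw [pseudoProd, e1, pseudoHat, map_mul, map_pow, map_mul, Complex.conj_I, Complex.conj_ofReal]
    have e4 : (-Complex.I * ξ) ^ k * (Complex.I * ξ) ^ k = (ξ : ℂ) ^ (2 * k) := by
      rw [← mul_pow, pow_mul]
      congr 1
      linear_combination (-(ξ : ℂ) ^ 2) * Complex.I_sq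
    rw [← e4]
    ring
  rw [energyWith, hI, Complex.re_ofReal_mul, ← mul_assoc]
  congr 2
  field_simp

/-- The truncated multiplier is bounded and vanishes for `|ξ| ≥ 1/ε`, so the transform is bounded
with compact support, and any power of `ξ` is harmless. -/
theorem memLp_pseudoHat_truncMult {p : ℝ → ℝ} {α : ℝ} {j : ℕ} (hα : α ∈ Set.Icc (-1 : ℝ) 1)
    (hj : 1 ≤ j) (hp : IsSymbol p α j) (u : L2) {ε : ℝ} (hε : 0 < ε) (k : ℕ) :
    MemLp (fun ξ : ℝ => (Complex.I * ξ) ^ k * pseudoHat (truncMult p ε) u u ξ) 2 volume := by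
  obtain ⟨K, hK⟩ := hp.exists_invPhase_le hα hj hε 1
  have hK0 : 0 ≤ K := (abs_nonneg _).trans (hK 0 0 0 (by simp))
  have hT : ∀ a b, |truncMult p ε a b| ≤ K := fun a b => by
    have h := hK a b (a + b) (by simp)
    rw [pow_one] at h
    rw [truncMult_eq, div_mul_eq_mul_div, abs_div, abs_two]
    linarith [abs_nonneg ((a + b) * invPhase p ε (a, b))]
  have hv := memLp_hat u
  have hv2 : Integrable fun ξ => ‖hat u ξ‖ ^ 2 := (memLp_two_iff_integrable_sq_norm hv.1).1 hv
  set Q := ∫ ξ, ‖hat u ξ‖ ^ 2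
  have hQ0 : 0 ≤ Q := integral_nonneg fun _ => by positivity
  have hm : AEStronglyMeasurable (fun ξ : ℝ => (Complex.I * ξ) ^ k *
      pseudoHat (truncMult p ε) u u ξ) := by
    refine (by fun_prop : Continuous fun ξ : ℝ =>
      (Complex.I * ξ) ^ k).aestronglyMeasurable.mul ?_
    refine AEStronglyMeasurable.integral_prod_right' (μ := volume) (ν := volume)
      (f := fun z : ℝ × ℝ =>
        (truncMult p ε (z.1 - z.2) z.2 : ℂ) * hat u (z.1 - z.2) * hat u z.2) ?_
    refine (AEStronglyMeasurable.mul ?_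
      (hv.1.comp_quasiMeasurePreserving quasiMeasurePreserving_sub)).mul
      (hv.1.comp_quasiMeasurePreserving Measure.quasiMeasurePreserving_snd)
    simp_rw [truncMult_eq]
    refine (Complex.measurable_ofReal.comp ((by fun_prop : Measurable fun z : ℝ × ℝ =>
      (z.1 - z.2 + z.2) / 2).mul ?_)).aestronglyMeasurable
    exact (measurable_invPhase hp.contDiff.continuous ε).comp
      ((measurable_fst.sub measurable_snd).prodMk measurable_snd)
  have hb : ∀ ξ, ‖pseudoHat (truncMult p ε) u u ξ‖ ≤ K * Q := fun ξ => by
    have h1 : Integrable fun η => ‖hat u (ξ - η)‖ ^ 2 := hv2.comp_sub_left ξ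
    have e : ∫ η, K * ((‖hat u (ξ - η)‖ ^ 2 + ‖hat u η‖ ^ 2) / 2) = K * Q := by
      rw [integral_const_mul, integral_div, integral_add h1 hv2,
        integral_sub_left_eq_self (fun x => ‖hat u x‖ ^ 2), add_self_div_two]
    rw [← e]
    refine norm_integral_le_of_norm_le (((h1.add hv2).div_const 2).const_mul K)
      (ae_of_all _ fun η => ?_)
    rw [mul_assoc, norm_mul, norm_mul, Complex.norm_real, Real.norm_eq_abs]
    refine mul_le_mul (hT _ _) ?_ (by positivity) hK0
    linarith [two_mul_le_add_sq ‖hat u (ξ - η)‖ ‖hat u η‖]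
  refine (memLp_indicator_const (μ := volume) 2 (measurableSet_Icc (a := -(1 / ε)) (b := 1 / ε))
    ((1 / ε) ^ k * (K * Q)) (Or.inr (by simp))).of_le hm (ae_of_all _ fun ξ => ?_)
  by_cases hξ : ξ ∈ Set.Icc (-(1 / ε)) (1 / ε)
  · rw [Set.indicator_of_mem hξ, Real.norm_of_nonneg (by positivity), norm_mul, norm_pow, norm_mul,
      Complex.norm_I, one_mul, Complex.norm_real, Real.norm_eq_abs]
    gcongr
    · exact abs_le.2 hξ
    · exact hb ξ
  · have h0 : pseudoHat (truncMult p ε) u u ξ = 0 := by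
      refine integral_eq_zero_of_ae (ae_of_all _ fun η => ?_)
      have hz : (ξ - η, η) ∉ truncSet ε := fun h => by
        have h3 := h.2.2.2
        simp only [sub_add_cancel] at h3
        exact hξ (abs_le.1 h3.le)
      simp [truncMult_of_notMem p hz]
    rw [h0, mul_zero, norm_zero]
    positivity

/-- The modified energy exists as a limit, with an explicit value. -/
theorem tendsto_energyWith {p : ℝ → ℝ} {α : ℝ} {j N k : ℕ} (hα : α ∈ Set.Icc (-1 : ℝ) 1)
    (hj : 1 ≤ j) (hp : IsSymbol p α j) (hN : 2 ≤ N) (hjk : j ≤ k) (hk : k ≤ N) {u : L2}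
    (hu : IsRealSobolev N u) :
    Tendsto (fun ε => energyWith (truncMult p ε) k u) (𝓝[>] (0 : ℝ))
      (𝓝 (‖dx k u‖ ^ 2 + Real.pi⁻¹ * (-(1 / 6) *
        ∫ z : ℝ × ℝ, (symMult p k (z.1 - z.2) z.2 : ℂ) * cubic (hat u) z).re)) ∧
    (ConvergesAbsolutely p k u →
      Tendsto (fun ε => energyWith (truncMult p ε) k u) (𝓝[>] (0 : ℝ))
        (𝓝 (energyWith (mult p) k u))) := by
  obtain ⟨C, -, hC⟩ := exists_integral_weight_le
  have hA := (hC N hN u hu).1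
  have hv := memLp_hat u
  have hv1 : Integrable (hat u) := by
    refine hA.mono' hv.1 (ae_of_all _ fun ξ => ?_)
    exact le_mul_of_one_le_left (norm_nonneg _) (by linarith [abs_nonneg ξ])
  have hE : ∀ᶠ ε in 𝓝[>] (0 : ℝ), ‖dx k u‖ ^ 2 + Real.pi⁻¹ *
      (∫ z, cubicIntegrand (truncMult p ε) k (hat u) z).re = energyWith (truncMult p ε) k u := by
    filter_upwards [self_mem_nhdsWithin] with ε hε
    refine (energyWith_eq hk hu ?_ (memLp_pseudoHat_truncMult hα hj hp u hε k)
      (integrable_cubicIntegrand_truncMult hα hj hp hv hv1 hε k)).symm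
    simpa using memLp_pseudoHat_truncMult hα hj hp u hε 0
  have hlim : ∀ L : ℂ, Tendsto (fun ε => ∫ z, cubicIntegrand (truncMult p ε) k (hat u) z)
      (𝓝[>] (0 : ℝ)) (𝓝 L) → Tendsto (fun ε => energyWith (truncMult p ε) k u) (𝓝[>] (0 : ℝ))
        (𝓝 (‖dx k u‖ ^ 2 + Real.pi⁻¹ * L.re)) := fun L hL =>
    ((((Complex.continuous_re.tendsto L).comp hL).const_mul _).const_add _).congr' hE
  refine ⟨hlim _ (tendsto_integral_truncMult hα hj hp hv hv1 (hat_neg hu.1) hjk hA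
    (integrable_weight_sq hk hu)), fun hac => ?_⟩
  rw [energyWith_eq hk hu hac.1 hac.2.1 hac.2.2]
  exact hlim _ (tendsto_integral_truncMult_of_integrable hp.contDiff.continuous hv.1 hac.2.2)

/-- The cubic part of the modified energy is controlled by `‖u‖_{H²} ‖u‖²_{Hᵏ}`. -/
theorem exists_abs_modifiedEnergy_sub_le {p : ℝ → ℝ} {α : ℝ} {j k : ℕ}
    (hα : α ∈ Set.Icc (-1 : ℝ) 1) (hj : 1 ≤ j) (hp : IsSymbol p α j) (hjk : j ≤ k) :
    ∃ C > 0, ∀ (N : ℕ) (_ : 2 ≤ N) (_ : k ≤ N) (u : L2), IsRealSobolev N u →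
      |modifiedEnergy p k u - ‖dx k u‖ ^ 2| ≤
        C * sobolevNorm 2 u * (‖u‖ ^ 2 + ‖dx k u‖ ^ 2) := by
  obtain ⟨A, hA0, hA⟩ := exists_integral_weight_le
  obtain ⟨S, hS0, hS⟩ := hp.symMult_le hα hj hjk
  -- The numerical factors cancel: `π⁻¹ · (1/6) · 3 · 2π = 1`.
  refine ⟨S * A * 4 ^ k, by positivity, fun N hN hk u hu => ?_⟩
  obtain ⟨hA1, hA2⟩ := hA N hN u hu
  have hlim := (tendsto_energyWith hα hj hp hN hjk hk hu).1
  rw [modifiedEnergy, hlim.limUnder_eq, add_sub_cancel_left]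
  obtain ⟨i1, b1⟩ := integral_triWeight_le k (memLp_hat u).1 hA1 (integrable_weight_sq hk hu)
  set J := ∫ z : ℝ × ℝ, (symMult p k (z.1 - z.2) z.2 : ℂ) * cubic (hat u) z
  have hJ : ‖J‖ ≤ S * ∫ z : ℝ × ℝ, triWeight k (z.1 - z.2) z.2 * ‖cubic (hat u) z‖ := by
    rw [← integral_const_mul]
    refine norm_integral_le_of_norm_le (i1.const_mul S) (ae_of_all _ fun z => ?_)
    rw [norm_mul, Complex.norm_real, Real.norm_eq_abs, ← mul_assoc]
    gcongr
    exact hS _ _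
  have hs0 : 0 ≤ sobolevNorm 2 u := Real.sqrt_nonneg _
  have hJ2 : ‖J‖ ≤ S * (3 * ((A * sobolevNorm 2 u) *
      (4 ^ k * (2 * Real.pi) * (‖u‖ ^ 2 + ‖dx k u‖ ^ 2)))) := by
    refine hJ.trans ?_
    gcongr
    refine b1.trans ?_
    gcongr
    exact integral_weight_sq_le hk hu
  rw [abs_mul, abs_of_pos (by positivity : 0 < Real.pi⁻¹)]
  calc Real.pi⁻¹ * |(-(1 / 6) * J).re| ≤ Real.pi⁻¹ * (1 / 6 * ‖J‖) := by
        gcongr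
        refine (Complex.abs_re_le_norm _).trans (le_of_eq ?_)
        rw [norm_mul]
        norm_num
    _ ≤ Real.pi⁻¹ * (1 / 6 * (S * (3 * ((A * sobolevNorm 2 u) *
          (4 ^ k * (2 * Real.pi) * (‖u‖ ^ 2 + ‖dx k u‖ ^ 2)))))) := by gcongr
    _ = _ := by field_simp; ring

end Whitham

end

theorem mainTheorem3 (p : ℝ → ℝ) (α : ℝ) (j N : ℕ)
    (hα : α ∈ Set.Icc (-1 : ℝ) 1) (hα0 : α ≠ 0) (hj : 1 ≤ j)
    (hp : Whitham.IsSymbol p α j) (hN : max 2 (2 * j - 1) ≤ N) :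
    ∃ C > 0, ∀ u : Whitham.L2, Whitham.IsRealSobolev N u →
      -- the modified energies are well defined
      (∀ k ∈ Finset.Icc (2 * j - 1) N,
        Tendsto (fun ε => Whitham.energyWith (Whitham.truncMult p ε) k u) (𝓝[>] (0 : ℝ))
          (𝓝 (Whitham.modifiedEnergy p k u)) ∧
        (Whitham.ConvergesAbsolutely p k u →
          Whitham.modifiedEnergy p k u = Whitham.energyWith (Whitham.mult p) k u)) ∧
      -- their sum is `1 + O(‖u‖_{H²})` times the squared norm of `Hᴺ`
      |(∑ k ∈ Finset.Icc (2 * j - 1) N, Whitham.modifiedEnergy p k u) + ‖u‖ ^ 2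
          - Whitham.energyNorm j N u ^ 2|
        ≤ C * Whitham.sobolevNorm 2 u * Whitham.energyNorm j N u ^ 2 ∧
      -- the norm used here is equivalent to the standard one
      Whitham.energyNorm j N u ≤ Whitham.sobolevNorm N u ∧
      Whitham.sobolevNorm N u ≤ C * Whitham.energyNorm j N u := by
  have hN2 : 2 ≤ N := (le_max_left _ _).trans hN
  have hNj : 2 * j - 1 ≤ N := (le_max_right _ _).trans hN
  have hC : ∀ k, ∃ C > 0, j ≤ k → ∀ (N : ℕ) (_ : 2 ≤ N) (_ : k ≤ N) (u : Whitham.L2),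
      Whitham.IsRealSobolev N u → |Whitham.modifiedEnergy p k u - ‖Whitham.dx k u‖ ^ 2| ≤
        C * Whitham.sobolevNorm 2 u * (‖u‖ ^ 2 + ‖Whitham.dx k u‖ ^ 2) := fun k => by
    by_cases hk : j ≤ k
    · obtain ⟨C, hC, h⟩ := Whitham.exists_abs_modifiedEnergy_sub_le hα hj hp hk
      exact ⟨C, hC, fun _ => h⟩
    -- A dummy constant, so that `choose` yields a function of all `k`.
    · exact ⟨1, one_pos, fun h => absurd h hk⟩
  choose C hC0 hC using hC
  have hsum : 0 ≤ ∑ k ∈ Finset.Icc (2 * j - 1) N, C k := Finset.sum_nonneg fun k _ => (hC0 k).le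
  -- The sum serves the energy estimate, and `N + 1` the equivalence of norms.
  refine ⟨(∑ k ∈ Finset.Icc (2 * j - 1) N, C k) + (N + 1), by positivity, fun u hu => ?_⟩
  have hE0 : 0 ≤ Whitham.energyNorm j N u := Real.sqrt_nonneg _
  have hS0 : 0 ≤ Whitham.sobolevNorm 2 u := Real.sqrt_nonneg _
  refine ⟨fun k hk => ?_, ?_, Whitham.energyNorm_le_sobolevNorm hj hu, ?_⟩
  · have hk' := Finset.mem_Icc.1 hk
    -- Here `k ≥ 2j - 1 ≥ j` because `j ≥ 1`.
    obtain ⟨h1, h2⟩ := Whitham.tendsto_energyWith hα hj hp hN2 (by omega : j ≤ k) hk'.2 hu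
    exact ⟨tendsto_nhds_limUnder ⟨_, h1⟩, fun hac => (h2 hac).limUnder_eq⟩
  · have e : (∑ k ∈ Finset.Icc (2 * j - 1) N, Whitham.modifiedEnergy p k u) + ‖u‖ ^ 2
          - Whitham.energyNorm j N u ^ 2 =
        ∑ k ∈ Finset.Icc (2 * j - 1) N,
          (Whitham.modifiedEnergy p k u - ‖Whitham.dx k u‖ ^ 2) := by
      rw [Whitham.energyNorm_sq, Finset.sum_sub_distrib]; ring
    rw [e]
    calc _ ≤ ∑ k ∈ Finset.Icc (2 * j - 1) N,
          |Whitham.modifiedEnergy p k u - ‖Whitham.dx k u‖ ^ 2| := Finset.abs_sum_le_sum_abs _ _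
      _ ≤ ∑ k ∈ Finset.Icc (2 * j - 1) N,
          C k * Whitham.sobolevNorm 2 u * Whitham.energyNorm j N u ^ 2 := by
        refine Finset.sum_le_sum fun k hk => ?_
        have hk' := Finset.mem_Icc.1 hk
        refine (hC k (by omega) N hN2 hk'.2 u hu).trans ?_
        have := hC0 k
        gcongr
        exact Whitham.add_norm_dx_sq_le_energyNorm_sq hk u
      _ = (∑ k ∈ Finset.Icc (2 * j - 1) N, C k) * Whitham.sobolevNorm 2 u *
          Whitham.energyNorm j N u ^ 2 := by rw [← Finset.sum_mul, ← Finset.sum_mul]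
      _ ≤ _ := by gcongr; linarith [(Nat.cast_nonneg N : (0 : ℝ) ≤ N)]
  · refine (Whitham.sobolevNorm_le_energyNorm hNj hu).trans ?_
    exact mul_le_mul_of_nonneg_right (by linarith) hE0
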